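/- **Theorem 3.** Let $N\ge 1$, $m\ge 0$, $D=[-\tfrac12,\tfrac12]^N$ with the Euclidean norm. Let $G_1,\dots,G_m$ (constraints) and $G_{m+1}$ (objective) be real functions, $G_i$ being needed only on $Q_i$, where $Q_1=D$, $Q_{i+1}=\{y\in Q_i: G_i(y)\le 0\}$, and let $$|G_i(y')-G_i(y'')|\le L_i\|y'-y''\|,\qquad y',y''\in Q_i,\ 1\le i\le m+1. $$ The problem is to minimize $G_{m+1}$ over $Q_{m+1}$. *Reduction.* A Peano-type ordering numbers, for every $M\ge0$, the $2^{MN}$ dyadic subcubes of $D$ of side $2^{-M}$ by $0,\dots,2^{MN}-1$ so that the subcube with number $v$ at level $M+1$ lies in the one with number $\lfloor v2^{-N}\rfloor$ at level $M$, and subcubes with consecutive numbers share a common $(N-1)$-dimensional face. Its Peano curve $y:[0,1]\to D$ sends every $x$ in the $v$-th subinterval $[v2^{-MN},(v+1)2^{-MN}]$ into the $v$-th subcube of level $M$, for all $M$. Its level-$d$ approximation $y_d$ is the polygonal line through the centers of the subcubes of level $d$ in their order, consecutive segments being run through linearly on equal parts of $[0,1]$. Let $\gamma$ be the Peano curve $y$,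 or an approximation $y_d$, of any Peano-type ordering, $g_i(x)=G_i(\gamma(x))$, $q_1=[0,1]$, $q_{i+1}=\{x\in q_i:g_i(x)\le0\}$, and assume $q_{m+1}\ne\emptyset$ (for $\gamma=y$ this means $Q_{m+1}\neq\emptyset$). Let the index $\nu(x)$ be the least $i\le m$ with $g_i(x)>0$, and $m+1$ if there is none. Put $g^*_{m+1}=\inf_{q_{m+1}}g_{m+1}$, and $\Phi(x)=g_{\nu(x)}(x)$ if $\nu(x)<m+1$, $\Phi(x)=g_{m+1}(x)-g_{m+1}^*$ if $\nu(x)=m+1$. *Algorithm* (parameters $\xi>0$ and $r>1$). The trial points are $x^0=0$, $x^1=1$, and, for $k\ge1$, $x^{k+1}$ is found as follows. 1. Let $0=x_0<x_1<\dots<x_k=1$ be the points $x^0,\dots,x^k$ in increasing order, $\nu_i=\nu(x_i)$, $\Delta_i=(x_i-x_{i-1})^{1/N}$. Put $z_i=g_{\nu_i}(x_i)$ if $\nu_i<m+1$, and $z_i=g_{m+1}(x_i)-z_k^*$ if $\nu_i=m+1$, where $z_k^*=\min\{g_{m+1}(x_i):0\le i\le k,\ \nu_i=m+1\}$. 2.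 $\mu_j=\max\{|z_p-z_q|(x_p-x_q)^{-1/N}: 0\le q<p\le k,\ \nu_p=\nu_q=j\}$, and $\mu_j=0$ if there is no such pair. 3. For $1\le i\le k$, $M_i=\max\{l_i,c_i,r_i,\gamma_i,\xi\}$, where $c_i=|z_i-z_{i-1}|/\Delta_i$ if $\nu_i=\nu_{i-1}$; $l_i=|z_{i-1}-z_{i-2}|/\Delta_{i-1}$ if $i\ge2$, $\nu_{i-2}=\nu_{i-1}\ge\nu_i$; $r_i=|z_{i+1}-z_i|/\Delta_{i+1}$ if $i\le k-1$, $\nu_{i+1}=\nu_i\ge\nu_{i-1}$; each of them is $0$ otherwise; and $\gamma_i=\mu_j\Delta_i/X_j^{\max}$ with $j=\max\{\nu_i,\nu_{i-1}\}$, $X_j^{\max}=\max\{\Delta_s:1\le s\le k,\ \max\{\nu_s,\nu_{s-1}\}=j\}$. 4. $R_i=\Delta_i+\frac{(z_i-z_{i-1})^2}{(rM_i)^2\Delta_i}-\frac{2(z_i+z_{i-1})}{rM_i}$ if $\nu_i=\nu_{i-1}$; $R_i=2\Delta_i-\frac{4z_i}{rM_i}$ if $\nu_i>\nu_{i-1}$;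 $R_i=2\Delta_i-\frac{4z_{i-1}}{rM_i}$ if $\nu_i<\nu_{i-1}$. Let $t$ be the least number with maximal $R_t$. 5. $x^{k+1}=\frac{x_t+x_{t-1}}2-\frac{\operatorname{sign}(z_t-z_{t-1})|z_t-z_{t-1}|^N}{2rM_t^N}$ if $\nu_t=\nu_{t-1}$, and $x^{k+1}=\frac{x_t+x_{t-1}}2$ otherwise. *Claim.* Put $$r^*=2^{3-1/N}\,\xi^{-1}\sqrt{N+3}\,\max_{1\le i\le m+1}L_i .$$ For every $r>1$ with $r>r^*$ and every minimizer $x^*$ of $\Phi$ over $[0,1]$: (a) at every iteration $k\ge1$, for every $1\le j\le k$ with $x^*\in[x_{j-1},x_j]$, $$rM_j>\begin{cases}2^{1-1/N}C_j+\sqrt{2^{2-2/N}C_j^2-D_j^2},&\nu_{j-1}=\nu_j,\\ 2C_j,&\nu_{j-1}\ne\nu_j,\end{cases}$$ the radicand being nonnegative. Here, with $a=z_{j-1}/(x^*-x_{j-1})^{1/N}$ and $b=z_j/(x_j-x^*)^{1/N}$, $C_j=a$ if $\nu_{j-1}>\nu_j$, $C_j=\max\{a,b\}$ if $\nu_{j-1}=\nu_j$,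 $C_j=b$ if $\nu_{j-1}<\nu_j$; $D_j=|z_j-z_{j-1}|/(x_j-x_{j-1})^{1/N}$ if $\nu_{j-1}=\nu_j$, and $D_j=0$ otherwise. (If $x^*$ is an end point of the interval, the quotient belonging to it is $0/0$ and is read as $0$.) (b) Hence, for the whole continuum of these values $r$, the method converges: $x^*$ is a limit point of the infinite sequence $\{x^k\}$ generated without a stopping rule. -/

import Mathlib

/-! ### Peano-type space-filling curves

The unit cube `[-1/2, 1/2]^N` is cut into `2^(M*N)` congruent closed subcubes of side `2^(-M)` and the
interval `[0, 1]` into `2^(M*N)` equal subintervals, for `M = 0, 1, 2, …`.  A Peano-type ordering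
numbers, at every level, the subcubes in such a way that subcubes and subintervals are nested in the
same way, and that consecutive subcubes have a common face.  The Peano curve sends a point of the
`v`-th subinterval of level `M` to a point of the `v`-th subcube of level `M`. -/

/-- A Peano-type ordering of the dyadic subcubes of the `N`-dimensional cube.  `cell M v` holds the
integer coordinates, between `0` and `2^M - 1`, of the subcube with number `v < 2^(M*N)` at level `M`
(the values for `v ≥ 2^(M*N)` are irrelevant). -/
structure PeanoOrder (N : ℕ) where
  cell : ℕ → ℕ → Fin N → ℕ
  cell_lt : ∀ M v, v < 2 ^ (M * N) → ∀ i, cell M v i < 2 ^ M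
  cell_inj : ∀ M, Set.InjOn (cell M) (Set.Iio (2 ^ (M * N)))
  nested : ∀ M v, v < 2 ^ ((M + 1) * N) → ∀ i, cell (M + 1) v i / 2 = cell M (v / 2 ^ N) i
  adjacent : ∀ M v, v + 1 < 2 ^ (M * N) → ∃ i,
    (cell M (v + 1) i = cell M v i + 1 ∨ cell M v i = cell M (v + 1) i + 1) ∧
      ∀ j, j ≠ i → cell M (v + 1) j = cell M v j

/-- A path through all vertices of the cube `{0,1}^(n+1)` between two adjacent vertices. -/
theorem gray_step {n : ℕ}
    (h : ∀ e : Fin n → Bool, ∃ p : ℕ → Fin n → Bool, p 0 = e ∧ Set.InjOn p (Set.Iio (2 ^ n)) ∧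
      ∀ v, v + 1 < 2 ^ n → ∃ i, p (v + 1) i ≠ p v i ∧ ∀ j, j ≠ i → p (v + 1) j = p v j)
    (e : Fin (n + 1) → Bool) (d : Fin (n + 1)) :
    ∃ p : ℕ → Fin (n + 1) → Bool, p 0 = e ∧ p (2 ^ (n + 1) - 1) = Function.update e d (!e d) ∧
      Set.InjOn p (Set.Iio (2 ^ (n + 1))) ∧
      ∀ v, v + 1 < 2 ^ (n + 1) → ∃ i, p (v + 1) i ≠ p v i ∧ ∀ j, j ≠ i → p (v + 1) j = p v j := by
  obtain ⟨q, q0, qinj, qadj⟩ := h (d.removeNth e)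
  have hpow : (2 : ℕ) ^ (n + 1) = 2 * 2 ^ n := by ring
  have hpos : 0 < 2 ^ n := by positivity
  refine ⟨fun v => if v < 2 ^ n then d.insertNth (e d) (q v)
    else d.insertNth (!e d) (q (2 ^ (n + 1) - 1 - v)), ?_, ?_, ?_, ?_⟩
  · simp [q0]
  · have h1 : ¬ (2 ^ (n + 1) - 1 < 2 ^ n) := by omega
    simp only [h1, if_false, Nat.sub_self, q0]
    ext j
    refine Fin.succAboveCases d ?_ (fun j => ?_) j <;> simp [Fin.removeNth]
  · intro a ha b hb hab
    simp only [Set.mem_Iio] at ha hb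
    have hd := congrFun hab d
    have hr : ∀ j, _ := fun j => congrFun hab (d.succAbove j)
    by_cases h1 : a < 2 ^ n <;> by_cases h2 : b < 2 ^ n <;>
      simp only [h1, h2, if_true, if_false, Fin.insertNth_apply_same,
        Fin.insertNth_apply_succAbove] at hd hr
    · exact qinj h1 h2 (funext hr)
    · simp at hd
    · simp at hd
    · have := qinj (x₁ := 2 ^ (n + 1) - 1 - a) (x₂ := 2 ^ (n + 1) - 1 - b)
        (by simp only [Set.mem_Iio]; omega) (by simp only [Set.mem_Iio]; omega) (funext hr)
      omega
  · intro v hv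
    by_cases h1 : v + 1 < 2 ^ n
    · obtain ⟨i, hi, hj⟩ := qadj v h1
      have h2 : v < 2 ^ n := by omega
      refine ⟨d.succAbove i, by simpa [h1, h2] using hi, fun j => ?_⟩
      refine Fin.succAboveCases d ?_ (fun j => ?_) j
      · simp [h1, h2]
      · intro hne
        simpa [h1, h2] using hj j (fun h => hne (by rw [h]))
    · by_cases h2 : v < 2 ^ n
      · have h3 : 2 ^ (n + 1) - 1 - (v + 1) = v := by omega
        refine ⟨d, by simp [h1, h2], fun j => ?_⟩
        refine Fin.succAboveCases d ?_ (fun j => ?_) j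
        · simp
        · intro _
          simp [h1, h2, h3]
      · obtain ⟨i, hi, hj⟩ := qadj (2 ^ (n + 1) - 1 - (v + 1)) (by omega)
        have h3 : 2 ^ (n + 1) - 1 - (v + 1) + 1 = 2 ^ (n + 1) - 1 - v := by omega
        rw [h3] at hi hj
        refine ⟨d.succAbove i, by simpa [h1, h2] using hi.symm, fun j => ?_⟩
        refine Fin.succAboveCases d ?_ (fun j => ?_) j
        · simp [h1, h2]
        · intro hne
          simpa [h1, h2] using (hj j (fun h => hne (by rw [h]))).symm

/-- A path through all vertices of the cube `{0,1}^n` with a given first vertex. -/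
theorem gray_start (n : ℕ) : ∀ e : Fin n → Bool, ∃ p : ℕ → Fin n → Bool, p 0 = e ∧
    Set.InjOn p (Set.Iio (2 ^ n)) ∧
      ∀ v, v + 1 < 2 ^ n → ∃ i, p (v + 1) i ≠ p v i ∧ ∀ j, j ≠ i → p (v + 1) j = p v j := by
  induction n with
  | zero =>
    intro e
    refine ⟨fun _ => e, rfl, fun a ha b hb _ => ?_, fun v hv => ?_⟩
    · simp at ha hb; omega
    · simp at hv
  | succ n ih =>
    intro e
    obtain ⟨p, h1, -, h2, h3⟩ := gray_step ih e 0
    exact ⟨p, h1, h2, h3⟩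

/-- An ordering of the subcubes of one level can be refined to one of the next level. -/
theorem exists_refinement {n : ℕ} (K : ℕ) (c : ℕ → Fin (n + 2) → ℕ)
    (hinj : Set.InjOn c (Set.Iio K))
    (hadj : ∀ v, v + 1 < K → ∃ i, (c (v + 1) i = c v i + 1 ∨ c v i = c (v + 1) i + 1) ∧
      ∀ j, j ≠ i → c (v + 1) j = c v j) :
    ∃ c' : ℕ → Fin (n + 2) → ℕ, (∀ v i, c' v i / 2 = c (v / 2 ^ (n + 2)) i) ∧
      Set.InjOn c' (Set.Iio (K * 2 ^ (n + 2))) ∧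
      ∀ v, v + 1 < K * 2 ^ (n + 2) →
        ∃ i, (c' (v + 1) i = c' v i + 1 ∨ c' v i = c' (v + 1) i + 1) ∧
          ∀ j, j ≠ i → c' (v + 1) j = c' v j := by
  choose! dir hdir1 hdir2 using hadj
  choose P P0 P1 Pinj Padj using gray_step (gray_start (n + 1))
  have hother : ∀ d : Fin (n + 2), ∃ d', d' ≠ d := exists_ne
  choose oth hoth using hother
  let t : ℕ → Bool := fun v => decide (c (v + 1) (dir v) = c v (dir v) + 1)
  let δ : ℕ → (Fin (n + 2) → Bool) → Fin (n + 2) := fun v e =>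
    if e (dir v) = t v then oth (dir v) else dir v
  let f : ℕ → (Fin (n + 2) → Bool) → Fin (n + 2) → Bool := fun v e =>
    Function.update e (δ v e) (!e (δ v e))
  have hf : ∀ v e, f v e (dir v) = t v := by
    intro v e
    by_cases h : e (dir v) = t v
    · simp only [f, δ, h, if_true]
      rw [Function.update_of_ne (hoth _).symm, h]
    · simp only [f, δ, h, if_false, Function.update_self]
      cases hh : e (dir v) <;> cases ht : t v <;> simp_all
  let E : ℕ → Fin (n + 2) → Bool := fun v =>
    Nat.rec (fun _ => false) (fun v e => Function.update (f v e) (dir v) (!t v)) v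
  have hE : ∀ v, E (v + 1) = Function.update (f v (E v)) (dir v) (!t v) := fun v => rfl
  have hpos : 0 < 2 ^ (n + 2) := by positivity
  set B := 2 ^ (n + 2) with hB
  let u : ℕ → Fin (n + 2) → Bool := fun v => P (E (v / B)) (δ (v / B) (E (v / B))) (v % B)
  refine ⟨fun v i => 2 * c (v / B) i + (u v i).toNat, ?_, ?_, ?_⟩
  · intro v i
    have := Bool.toNat_le (u v i)
    simp only
    omega
  · intro a ha b hb hab
    simp only [Set.mem_Iio] at ha hb
    have h1 : a / B = b / B := by
      apply hinj
      · exact Nat.div_lt_of_lt_mul (by rwa [mul_comm])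
      · exact Nat.div_lt_of_lt_mul (by rwa [mul_comm])
      · ext i
        have h2 := congrFun hab i
        have := Bool.toNat_le (u a i)
        have := Bool.toNat_le (u b i)
        simp only at h2
        omega
    have h2 : u a = u b := by
      ext1 i
      have h2 := congrFun hab i
      simp only [h1] at h2
      have h3 : (u a i).toNat = (u b i).toNat := by omega
      revert h3
      cases u a i <;> cases u b i <;> simp
    simp only [u, h1] at h2
    have h3 := Pinj _ _ (Nat.mod_lt _ hpos) (Nat.mod_lt _ hpos) h2
    rw [← Nat.div_add_mod a B, ← Nat.div_add_mod b B, h1, h3]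
  · intro v hv
    by_cases hm : v % B + 1 < B
    · have hd : (v + 1) / B = v / B := by
        rw [Nat.div_eq_iff hpos]
        have := Nat.div_add_mod v B
        have h4 : v / B * B = B * (v / B) := mul_comm _ _
        constructor <;> omega
      have hmod : (v + 1) % B = v % B + 1 := by
        rw [Nat.add_mod, Nat.mod_eq_of_lt (a := 1) (by omega), Nat.mod_eq_of_lt hm]
      obtain ⟨i, hi, hj⟩ := Padj (E (v / B)) (δ (v / B) (E (v / B))) (v % B) hm
      refine ⟨i, ?_, fun j hne => ?_⟩
      · simp only [u, hd, hmod]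
        revert hi
        cases P (E (v / B)) (δ (v / B) (E (v / B))) (v % B + 1) i <;>
          cases P (E (v / B)) (δ (v / B) (E (v / B))) (v % B) i <;> simp
      · simp only [u, hd, hmod, hj j hne]
    · have hlt := Nat.mod_lt v hpos
      have hm' : v % B = B - 1 := by omega
      have hv1 : v + 1 = B * (v / B + 1) := by
        have := Nat.div_add_mod v B
        rw [mul_add]; omega
      have hd : (v + 1) / B = v / B + 1 := by rw [hv1, Nat.mul_div_cancel_left _ hpos]
      have hmod : (v + 1) % B = 0 := by rw [hv1, Nat.mul_mod_right]
      set w := v / B with hw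
      have hwK : w + 1 < K := by
        rw [hv1, mul_comm] at hv
        exact lt_of_mul_lt_mul_right hv (Nat.zero_le _)
      have hu : u v = f w (E w) := by simp only [u, ← hw, hm', P1, f]
      have hu' : u (v + 1) = Function.update (f w (E w)) (dir w) (!t w) := by
        simp only [u, hd, hmod, P0, hE]
      refine ⟨dir w, ?_, fun j hne => ?_⟩
      · simp only [hd, hu, hu', hf, Function.update_self]
        rw [← hw]
        by_cases ht : c (w + 1) (dir w) = c w (dir w) + 1
        · simp only [t, ht, decide_true, Bool.not_true, Bool.toNat_true, Bool.toNat_false]; omega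
        · have := (hdir1 w hwK).resolve_left ht
          simp only [t, ht, decide_false, Bool.not_false, Bool.toNat_true, Bool.toNat_false]; omega
      · simp only [hd, hu, hu', Function.update_of_ne hne, hdir2 w hwK j hne]
        rw [← hw]

/-- Peano-type orderings exist in every dimension. -/
theorem PeanoOrder.nonempty (N : ℕ) (hN : 1 ≤ N) : Nonempty (PeanoOrder N) := by
  obtain rfl | ⟨n, rfl⟩ : N = 1 ∨ ∃ n, N = n + 2 := by
    rcases N with _ | _ | n
    · omega
    · exact Or.inl rfl
    · exact Or.inr ⟨n, rfl⟩
  · refine ⟨⟨fun _ v _ => v, fun M v hv _ => by simpa using hv, fun M a _ b _ h => congrFun h 0,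
      fun M v _ _ => by simp, fun M v _ => ⟨0, Or.inl rfl, fun j hj => ?_⟩⟩⟩
    exact absurd (Subsingleton.elim j 0) hj
  · let A : ℕ → Type := fun K => {c : ℕ → Fin (n + 2) → ℕ // Set.InjOn c (Set.Iio K) ∧
      ∀ v, v + 1 < K → ∃ i, (c (v + 1) i = c v i + 1 ∨ c v i = c (v + 1) i + 1) ∧
        ∀ j, j ≠ i → c (v + 1) j = c v j}
    have step : ∀ M, ∀ a : A (2 ^ (M * (n + 2))), ∃ b : A (2 ^ ((M + 1) * (n + 2))),
        ∀ v i, b.1 v i / 2 = a.1 (v / 2 ^ (n + 2)) i := by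
      intro M a
      obtain ⟨c', h1, h2, h3⟩ := exists_refinement _ a.1 a.2.1 a.2.2
      have hK : 2 ^ (M * (n + 2)) * 2 ^ (n + 2) = 2 ^ ((M + 1) * (n + 2)) := by
        rw [← pow_add]; ring_nf
      rw [hK] at h2 h3
      exact ⟨⟨c', h2, h3⟩, h1⟩
    choose F hF using step
    let a0 : A (2 ^ (0 * (n + 2))) := ⟨fun _ _ => 0,
      fun a ha b hb _ => by simp at ha hb; omega, fun v hv => by simp at hv⟩
    let a : ∀ M, A (2 ^ (M * (n + 2))) := fun M => Nat.rec a0 (fun M b => F M b) M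
    have ha : ∀ M v i, (a (M + 1)).1 v i / 2 = (a M).1 (v / 2 ^ (n + 2)) i :=
      fun M => hF M (a M)
    refine ⟨⟨fun M => (a M).1, ?_, fun M => (a M).2.1, fun M v _ i => ha M v i,
      fun M => (a M).2.2⟩⟩
    intro M
    induction M with
    | zero => intro v _ i; simp [a, a0]
    | succ M ih =>
      intro v hv i
      have h1 := ha M v i
      have h2 := ih (v / 2 ^ (n + 2)) (Nat.div_lt_of_lt_mul (by
        rw [← pow_add]; convert hv using 2; ring)) i
      rw [pow_succ]
      omega

namespace PeanoOrder

/-- The Peano curve `y(x)`, `0 ≤ x ≤ 1`, of a Peano-type ordering.  At level `M` the point `x` lies in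
the subinterval with number `⌊x 2^(M*N)⌋` (the last one if `x = 1`), and `y(x)` is the only common
point of the corresponding nested subcubes, that is, the supremum of their lower corners. -/
noncomputable def curve {N : ℕ} (S : PeanoOrder N) (x : ℝ) : EuclideanSpace ℝ (Fin N) :=
  WithLp.toLp 2 fun i =>
    -1 / 2 + ⨆ M : ℕ, (S.cell M (min ⌊x * 2 ^ (M * N)⌋₊ (2 ^ (M * N) - 1)) i : ℝ) / 2 ^ M

/-- The center of the subcube with number `v` at level `d`. -/
noncomputable def center {N : ℕ} (S : PeanoOrder N) (d v : ℕ) : EuclideanSpace ℝ (Fin N) :=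
  WithLp.toLp 2 fun i => -1 / 2 + ((S.cell d v i : ℝ) + 1 / 2) / 2 ^ d

/-- The level-`d` approximation `y_d(x)`, `0 ≤ x ≤ 1`, of the Peano curve: the polygonal line through
the centers of the subcubes of level `d` in their order, the `2^(d*N) - 1` segments corresponding to
equal parts of `[0, 1]`. -/
noncomputable def polygon {N : ℕ} (S : PeanoOrder N) (d : ℕ) (x : ℝ) : EuclideanSpace ℝ (Fin N) :=
  let t : ℝ := x * (2 ^ (d * N) - 1)
  S.center d ⌊t⌋₊ + (t - ⌊t⌋₊) • (S.center d (⌊t⌋₊ + 1) - S.center d ⌊t⌋₊)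

end PeanoOrder

/-! ### The constrained problem and its one-dimensional reduction

The functions `G 0, …, G (m - 1)` are the constraints and `G m` is the objective function.  Only the
values of `G i` on `region G i` play a role below. -/

/-- The search domain `D = [-1/2, 1/2]^N`. -/
def searchCube (N : ℕ) : Set (EuclideanSpace ℝ (Fin N)) :=
  {y | ∀ i, -1 / 2 ≤ y i ∧ y i ≤ 1 / 2}

/-- The set of the points of `D` at which all constraints preceding the `i`-th function hold: the
domain of that function.  The feasible region is `region G (Fin.last m)`. -/
def region {N m : ℕ} (G : Fin (m + 1) → EuclideanSpace ℝ (Fin N) → ℝ) (i : Fin (m + 1)) :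
    Set (EuclideanSpace ℝ (Fin N)) :=
  {y | y ∈ searchCube N ∧ ∀ j, j < i → G j y ≤ 0}

/-- The reduced functions `g_i(x) = G_i(γ(x))` for a curve `γ`. -/
def reduced {N m : ℕ} (G : Fin (m + 1) → EuclideanSpace ℝ (Fin N) → ℝ)
    (γ : ℝ → EuclideanSpace ℝ (Fin N)) (i : Fin (m + 1)) (x : ℝ) : ℝ :=
  G i (γ x)

section Reduction

variable {m : ℕ} (g : Fin (m + 1) → ℝ → ℝ)

/-- The domain of the `i`-th reduced function in `[0, 1]`. -/
def reducedRegion (i : Fin (m + 1)) : Set ℝ :=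
  {x | x ∈ Set.Icc 0 1 ∧ ∀ j, j < i → g j x ≤ 0}

open Classical in
/-- The index `ν(x)`: the number of the first violated constraint, or that of the objective function
if no constraint is violated. -/
noncomputable def index (x : ℝ) : Fin (m + 1) :=
  (Finset.univ.filter fun j : Fin (m + 1) => j = Fin.last m ∨ 0 < g j x).min' ⟨Fin.last m, by simp⟩

/-- The minimal value of the reduced problem. -/
noncomputable def optValue : ℝ := sInf (g (Fin.last m) '' reducedRegion g (Fin.last m))

open Classical in
/-- The auxiliary function `Φ`. -/
noncomputable def auxFun (x : ℝ) : ℝ :=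
  g (index g x) x - if index g x = Fin.last m then optValue g else 0

/-- `x` is a solution of the unconstrained problem `Φ(x) → min`, `x ∈ [0, 1]`. -/
def IsSolution (x : ℝ) : Prop :=
  x ∈ Set.Icc (0 : ℝ) 1 ∧ ∀ x' ∈ Set.Icc (0 : ℝ) 1, auxFun g x ≤ auxFun g x'

end Reduction

/-! ### The algorithm

`T` is the finite set of the trial points of the iterations `0, …, k`; it has `k + 1` elements. -/

/-- The trial points in increasing order: `point T 0 < point T 1 < ⋯ < point T k`. -/
noncomputable def point (T : Finset ℝ) (i : ℕ) : ℝ := (T.sort (· ≤ ·)).getD i 0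

section Algorithm

variable (N : ℕ) {m : ℕ} (g : Fin (m + 1) → ℝ → ℝ) (ξ r : ℝ) (T : Finset ℝ)

/-- The index `ν_i` of the `i`-th point. -/
noncomputable def nu (i : ℕ) : Fin (m + 1) := index g (point T i)

/-- The best value `z_k^*` of the objective function at the trial points that satisfy all constraints
(used only if there are such points). -/
noncomputable def bestValue : ℝ :=
  sInf (g (Fin.last m) '' {x | x ∈ T ∧ index g x = Fin.last m})

open Classical in
/-- The value `z` at a trial point `x`. -/
noncomputable def zAt (x : ℝ) : ℝ :=
  g (index g x) x - if index g x = Fin.last m then bestValue g T else 0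

/-- The value `z_i` at the `i`-th point. -/
noncomputable def zval (i : ℕ) : ℝ := zAt g T (point T i)

/-- The length `Δ_i = (x_i - x_(i-1))^(1/N)` of the `i`-th interval in the Hölder metric. -/
noncomputable def hlen (i : ℕ) : ℝ := (point T i - point T (i - 1)) ^ (1 / (N : ℝ))

/-- The lower bound `μ_j` of the Hölder constant of `g_j`; it is `0` (the supremum of the empty set)
if fewer than two trial points have the index `j`. -/
noncomputable def muBound (j : Fin (m + 1)) : ℝ :=
  sSup {s | ∃ p ∈ T, ∃ q ∈ T, q < p ∧ index g p = j ∧ index g q = j ∧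
    s = |zAt g T p - zAt g T q| / (p - q) ^ (1 / (N : ℝ))}

/-- The Hölder quotient `|z_i - z_(i-1)| / (x_i - x_(i-1))^(1/N)`. -/
noncomputable def hquot (i : ℕ) : ℝ := |zval g T i - zval g T (i - 1)| / hlen N T i

open Classical in
/-- `c_i`. -/
noncomputable def cEst (i : ℕ) : ℝ := if nu g T i = nu g T (i - 1) then hquot N g T i else 0

open Classical in
/-- `l_i`. -/
noncomputable def lEst (i : ℕ) : ℝ :=
  if 2 ≤ i ∧ nu g T (i - 2) = nu g T (i - 1) ∧ nu g T i ≤ nu g T (i - 1)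
  then hquot N g T (i - 1) else 0

open Classical in
/-- `r_i`; the number of intervals is `k = T.card - 1`. -/
noncomputable def rEst (i : ℕ) : ℝ :=
  if i + 1 ≤ T.card - 1 ∧ nu g T (i + 1) = nu g T i ∧ nu g T (i - 1) ≤ nu g T i
  then hquot N g T (i + 1) else 0

/-- `λ_i`. -/
noncomputable def lambdaEst (i : ℕ) : ℝ := max (max (lEst N g T i) (cEst N g T i)) (rEst N g T i)

/-- The index `max {ν_i, ν_(i-1)}` of the `i`-th interval. -/
noncomputable def intervalIndex (i : ℕ) : Fin (m + 1) := max (nu g T i) (nu g T (i - 1))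

/-- `X_j^max`. -/
noncomputable def maxLen (j : Fin (m + 1)) : ℝ :=
  sSup {s | ∃ i, 1 ≤ i ∧ i ≤ T.card - 1 ∧ intervalIndex g T i = j ∧ s = hlen N T i}

/-- `γ_i`. -/
noncomputable def gammaEst (i : ℕ) : ℝ :=
  muBound N g T (intervalIndex g T i) * hlen N T i / maxLen N g T (intervalIndex g T i)

/-- The local estimate `M_i = max {λ_i, γ_i, ξ}`. -/
noncomputable def mEst (i : ℕ) : ℝ := max (max (lambdaEst N g T i) (gammaEst N g T i)) ξ

open Classical in
/-- The characteristic `R_i` of the `i`-th interval. -/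
noncomputable def charac (i : ℕ) : ℝ :=
  if nu g T i = nu g T (i - 1) then
    hlen N T i + (zval g T i - zval g T (i - 1)) ^ 2 / ((r * mEst N g ξ T i) ^ 2 * hlen N T i)
      - 2 * (zval g T i + zval g T (i - 1)) / (r * mEst N g ξ T i)
  else if nu g T (i - 1) < nu g T i then
    2 * hlen N T i - 4 * zval g T i / (r * mEst N g ξ T i)
  else
    2 * hlen N T i - 4 * zval g T (i - 1) / (r * mEst N g ξ T i)

/-- The least number `t` of an interval with the maximal characteristic. -/
noncomputable def bestInterval : ℕ :=
  sInf {i | 1 ≤ i ∧ i ≤ T.card - 1 ∧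
    ∀ j, 1 ≤ j → j ≤ T.card - 1 → charac N g ξ r T j ≤ charac N g ξ r T i}

open Classical in
/-- The new trial point in the interval with the number `t`. -/
noncomputable def newPoint (t : ℕ) : ℝ :=
  if nu g T t = nu g T (t - 1) then
    (point T t + point T (t - 1)) / 2
      - Real.sign (zval g T t - zval g T (t - 1)) * |zval g T t - zval g T (t - 1)| ^ N
        / (2 * r * mEst N g ξ T t ^ N)
  else (point T t + point T (t - 1)) / 2

/-- The set `{x^0, …, x^k}` of the first `k + 1` trial points, `x^0 = 0`, `x^1 = 1`. -/
noncomputable def trialSet : ℕ → Finset ℝ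
  | 0 => {0}
  | 1 => {0, 1}
  | k + 2 => insert (newPoint N g ξ r (trialSet (k + 1)) (bestInterval N g ξ r (trialSet (k + 1))))
      (trialSet (k + 1))

/-- The sequence `x^0, x^1, x^2, …` of the trial points of the method without a stopping rule. -/
noncomputable def trial : ℕ → ℝ
  | 0 => 0
  | 1 => 1
  | k + 2 => newPoint N g ξ r (trialSet N g ξ r (k + 1))
      (bestInterval N g ξ r (trialSet N g ξ r (k + 1)))

/-! ### The convergence condition -/

/-- The value `C_j` for a point `xs` of the `j`-th interval.  If `xs` is an end point of the interval
and a solution, then the quotient belonging to that end point is `0 / 0`, read as `0`. -/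
noncomputable def cVal (xs : ℝ) (j : ℕ) : ℝ :=
  let left := zval g T (j - 1) / (xs - point T (j - 1)) ^ (1 / (N : ℝ))
  let right := zval g T j / (point T j - xs) ^ (1 / (N : ℝ))
  if nu g T j < nu g T (j - 1) then left
  else if nu g T (j - 1) < nu g T j then right
  else max left right

open Classical in
/-- The value `D_j`. -/
noncomputable def dVal (j : ℕ) : ℝ :=
  if nu g T (j - 1) = nu g T j then hquot N g T j else 0

open Classical in
/-- The sufficient convergence condition for the `j`-th interval, which contains `xs`; that the
radicand is nonnegative is a part of it. -/
def ConvCondition (xs : ℝ) (j : ℕ) : Prop :=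
  if nu g T (j - 1) = nu g T j then
    0 ≤ (2 : ℝ) ^ (2 - 2 / (N : ℝ)) * cVal N g T xs j ^ 2 - dVal N g T j ^ 2 ∧
    (2 : ℝ) ^ (1 - 1 / (N : ℝ)) * cVal N g T xs j
        + √((2 : ℝ) ^ (2 - 2 / (N : ℝ)) * cVal N g T xs j ^ 2 - dVal N g T j ^ 2)
      < r * mEst N g ξ T j
  else 2 * cVal N g T xs j < r * mEst N g ξ T j

end Algorithm

/-! Write q = 2^(1-1/N). Two parameters at distance at most 2^(-MN) are sent into equal or
face-adjacent subcubes of level M, whose union has diameter at most √(N+3)·2^(-M). Taking the finest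
such M gives `PeanoOrder.holder`: both kinds of curve are Hölder with exponent 1/N and constant
2√(N+3). Hence every reduced function is Hölder on its domain with H = 2√(N+3)·max L.

At a solution xs all constraints hold and the objective is minimal. So the value z at a trial point
x is at most g_ν(x) - g_ν(xs), hence at most H|x - xs|^(1/N) (`zAt_le`). The hypothesis r > r* says
precisely that rξ > 2qH. Since M_j ≥ ξ and C_j ≤ H, the condition (a) follows
(`convCondition_of_lt`).

Convergence is not deduced from (a) but from the same inequality, which leaves a margin ε = 1 -
2qH/(rξ) > 0 independent of the iteration. An interval containing xs has R_j ≥ εΔ_j (`le_charac`),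
while every interval has R_i ≤ 2Δ_i (`charac_le`). If xs were not a limit point, the intervals
around it would keep a length at least ρ > 0. Then every interval selected for subdivision would be
long too, and each new point, which divides its interval in a bounded ratio, would stay a fixed
distance away from all earlier ones. This is impossible in [0, 1]. -/

/-! ### The Hölder condition for Peano curves and their approximations -/

namespace PeanoOrder

variable {N : ℕ} (S : PeanoOrder N)

/-- The closed subcube with number `v` at level `M`. -/
def box (M v : ℕ) : Set (EuclideanSpace ℝ (Fin N)) :=
  {y | ∀ i, -1 / 2 + (S.cell M v i : ℝ) / 2 ^ M ≤ y i ∧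
    y i ≤ -1 / 2 + ((S.cell M v i : ℝ) + 1) / 2 ^ M}

theorem box_subset_searchCube {M v : ℕ} (hv : v < 2 ^ (M * N)) : S.box M v ⊆ searchCube N := by
  intro y hy i
  obtain ⟨h1, h2⟩ := hy i
  have hc : (S.cell M v i : ℝ) + 1 ≤ 2 ^ M := by exact_mod_cast S.cell_lt M v hv i
  have h3 : ((S.cell M v i : ℝ) + 1) / 2 ^ M ≤ 1 := (div_le_one (by positivity)).2 hc
  have h4 : 0 ≤ (S.cell M v i : ℝ) / 2 ^ M := by positivity
  constructor <;> linarith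

theorem box_succ_subset {M v : ℕ} (hv : v < 2 ^ ((M + 1) * N)) :
    S.box (M + 1) v ⊆ S.box M (v / 2 ^ N) := by
  intro y hy i
  obtain ⟨h1, h2⟩ := hy i
  have hn := S.nested M v hv i
  have l1 : 2 * S.cell M (v / 2 ^ N) i ≤ S.cell (M + 1) v i := by omega
  have l2 : S.cell (M + 1) v i + 1 ≤ 2 * (S.cell M (v / 2 ^ N) i + 1) := by omega
  have l1' : 2 * (S.cell M (v / 2 ^ N) i : ℝ) ≤ S.cell (M + 1) v i := by exact_mod_cast l1
  have l2' : (S.cell (M + 1) v i : ℝ) + 1 ≤ 2 * (S.cell M (v / 2 ^ N) i + 1) := by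
    exact_mod_cast l2
  have e1 : (S.cell M (v / 2 ^ N) i : ℝ) / 2 ^ M ≤ S.cell (M + 1) v i / 2 ^ (M + 1) := by
    rw [div_le_div_iff₀ (by positivity) (by positivity), pow_succ]
    nlinarith [show (0 : ℝ) < 2 ^ M by positivity]
  have e2 : ((S.cell (M + 1) v i : ℝ) + 1) / 2 ^ (M + 1) ≤
      ((S.cell M (v / 2 ^ N) i : ℝ) + 1) / 2 ^ M := by
    rw [div_le_div_iff₀ (by positivity) (by positivity), pow_succ]
    nlinarith [show (0 : ℝ) < 2 ^ M by positivity]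
  constructor <;> linarith

theorem box_add_subset {M v : ℕ} (e : ℕ) (hv : v < 2 ^ ((M + e) * N)) :
    S.box (M + e) v ⊆ S.box M (v / 2 ^ (e * N)) := by
  induction e generalizing v with
  | zero => simp
  | succ e ih =>
    have h : v / 2 ^ N < 2 ^ ((M + e) * N) := by
      apply Nat.div_lt_of_lt_mul
      rw [← pow_add]
      convert hv using 2
      ring
    refine (S.box_succ_subset (M := M + e) hv).trans ((ih h).trans ?_)
    rw [Nat.div_div_eq_div_mul, ← pow_add, show N + e * N = (e + 1) * N by ring]

/-- Points of subcubes with equal or consecutive numbers are close to each other. -/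
theorem norm_sub_le_of_mem_box {M v w : ℕ} (hw : w < 2 ^ (M * N)) (hvw : w = v ∨ w = v + 1)
    {y z : EuclideanSpace ℝ (Fin N)} (hy : y ∈ S.box M v) (hz : z ∈ S.box M w) :
    ‖y - z‖ ≤ √((N : ℝ) + 3) / 2 ^ M := by
  have hp : (0 : ℝ) < 2 ^ M := by positivity
  -- In units of 2^(-M), the union of two adjacent subcubes has one side 2 and N - 1 sides 1, so the
  -- squared diameter is 4 + (N - 1) = N + 3.
  obtain ⟨c, hc, hsum⟩ : ∃ c : Fin N → ℝ, (∀ i, |y i - z i| ≤ c i / 2 ^ M) ∧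
      ∑ i, c i ^ 2 ≤ (N : ℝ) + 3 := by
    rcases hvw with rfl | rfl
    · refine ⟨fun _ => 1, fun i => ?_, by simp⟩
      obtain ⟨h1, h2⟩ := hy i
      obtain ⟨h3, h4⟩ := hz i
      rw [add_div] at h2 h4
      rw [abs_le]
      constructor <;> linarith
    · obtain ⟨i₀, h0, hne⟩ := S.adjacent M v hw
      refine ⟨fun i => if i = i₀ then 2 else 1, fun i => ?_, ?_⟩
      · obtain ⟨h1, h2⟩ := hy i
        obtain ⟨h3, h4⟩ := hz i
        by_cases hi : i = i₀
        · subst hi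
          simp only [if_true]
          have e : (2 : ℝ) / 2 ^ M = 1 / 2 ^ M + 1 / 2 ^ M := by ring
          have hpos : (0 : ℝ) < 1 / 2 ^ M := by positivity
          rw [abs_le]
          rcases h0 with h0 | h0
          · have h0' : (S.cell M (v + 1) i : ℝ) = S.cell M v i + 1 := by exact_mod_cast h0
            rw [add_div] at h2 h4
            rw [h0', add_div] at h3 h4
            constructor <;> linarith
          · have h0' : (S.cell M v i : ℝ) = S.cell M (v + 1) i + 1 := by exact_mod_cast h0
            rw [add_div] at h2 h4
            rw [h0', add_div] at h1 h2
            constructor <;> linarith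
        · simp only [hi, if_false]
          rw [hne i hi] at h3 h4
          rw [add_div] at h2 h4
          rw [abs_le]
          constructor <;> linarith
      · have : ∀ i : Fin N, (if i = i₀ then (2 : ℝ) else 1) ^ 2 = 1 + if i = i₀ then 3 else 0 := by
          intro i
          split_ifs <;> norm_num
        simp only [this, Finset.sum_add_distrib]
        simp
  rw [EuclideanSpace.norm_eq]
  have hle : ∑ i, ‖(y - z) i‖ ^ 2 ≤ (√((N : ℝ) + 3) / 2 ^ M) ^ 2 := by
    rw [div_pow, Real.sq_sqrt (by positivity)]
    refine le_trans (Finset.sum_le_sum fun i _ => ?_) (b := ∑ i, (c i / 2 ^ M) ^ 2) ?_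
    · rw [Real.norm_eq_abs]
      exact pow_le_pow_left₀ (abs_nonneg _) (by simpa using hc i) 2
    · simp only [div_pow, ← Finset.sum_div]
      gcongr
  exact (Real.sqrt_le_sqrt hle).trans_eq (Real.sqrt_sq (by positivity))

/-! ### The Peano curve inside nested subcubes -/

/-- The number of the subinterval of level `M` that contains `x`. -/
noncomputable def interval (N M : ℕ) (x : ℝ) : ℕ := min ⌊x * 2 ^ (M * N)⌋₊ (2 ^ (M * N) - 1)

theorem interval_lt (M : ℕ) (x : ℝ) : interval N M x < 2 ^ (M * N) := by
  have : 0 < 2 ^ (M * N) := by positivity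
  unfold interval
  omega

/-- Floors commute with division by 2^N, and so does the truncation at the last subinterval, which
takes care of x = 1. -/
theorem interval_succ_div (M : ℕ) (x : ℝ) :
    interval N (M + 1) x / 2 ^ N = interval N M x := by
  have hB : 0 < 2 ^ N := by positivity
  have hK : 0 < 2 ^ (M * N) := by positivity
  have hmul : (2 : ℕ) ^ ((M + 1) * N) = 2 ^ (M * N) * 2 ^ N := by rw [← pow_add]; ring_nf
  have hfl : ⌊x * 2 ^ ((M + 1) * N)⌋₊ / 2 ^ N = ⌊x * 2 ^ (M * N)⌋₊ := by
    have := Nat.floor_div_natCast (x * 2 ^ ((M + 1) * N)) (2 ^ N)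
    rw [← this]
    congr 1
    push_cast
    rw [show (M + 1) * N = M * N + N by ring, pow_add]
    field_simp
  have hmono : Monotone fun a : ℕ => a / 2 ^ N := fun a b h => Nat.div_le_div_right h
  have h1 : (2 ^ (M * N) * 2 ^ N - 1) / 2 ^ N = 2 ^ (M * N) - 1 := by
    obtain ⟨K, hKe⟩ : ∃ K, 2 ^ (M * N) = K + 1 := ⟨_, (Nat.succ_pred_eq_of_pos hK).symm⟩
    rw [hKe, Nat.div_eq_iff hB, Nat.add_sub_cancel]
    have : (K + 1) * 2 ^ N = K * 2 ^ N + 2 ^ N := by ring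
    constructor <;> omega
  unfold interval
  rw [hmono.map_min (a := ⌊x * 2 ^ ((M + 1) * N)⌋₊), hfl, hmul, h1]

theorem cell_interval_mono (x : ℝ) (i : Fin N) :
    Monotone fun M => (S.cell M (interval N M x) i : ℝ) / 2 ^ M := by
  refine monotone_nat_of_le_succ fun M => ?_
  have hn := S.nested M _ (interval_lt (M + 1) x) i
  rw [interval_succ_div] at hn
  have l1 : 2 * (S.cell M (interval N M x) i : ℝ) ≤ S.cell (M + 1) (interval N (M + 1) x) i := by
    exact_mod_cast (by omega : 2 * S.cell M (interval N M x) i ≤ _)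
  rw [div_le_div_iff₀ (by positivity) (by positivity), pow_succ]
  nlinarith [show (0 : ℝ) < 2 ^ M by positivity]

theorem cell_interval_add_one_anti (x : ℝ) (i : Fin N) :
    Antitone fun M => ((S.cell M (interval N M x) i : ℝ) + 1) / 2 ^ M := by
  refine antitone_nat_of_succ_le fun M => ?_
  have hn := S.nested M _ (interval_lt (M + 1) x) i
  rw [interval_succ_div] at hn
  have l1 : (S.cell (M + 1) (interval N (M + 1) x) i : ℝ) + 1 ≤
      2 * (S.cell M (interval N M x) i + 1) := by
    exact_mod_cast (by omega : _ ≤ 2 * (S.cell M (interval N M x) i + 1))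
  rw [div_le_div_iff₀ (by positivity) (by positivity), pow_succ]
  nlinarith [show (0 : ℝ) < 2 ^ M by positivity]

/-- Lower corners increase and upper corners decrease with the level, so the supremum of the lower
corners lies below every upper corner. -/
theorem curve_mem_box (M : ℕ) (x : ℝ) : S.curve x ∈ S.box M (interval N M x) := by
  intro i
  have hle : ∀ M', (S.cell M' (interval N M' x) i : ℝ) / 2 ^ M' ≤
      ((S.cell M (interval N M x) i : ℝ) + 1) / 2 ^ M := by
    intro M'
    refine (S.cell_interval_mono x i (le_max_left M' M)).trans
      (le_trans ?_ (S.cell_interval_add_one_anti x i (le_max_right M' M)))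
    simp only
    gcongr
    linarith
  have h1 : (S.cell M (interval N M x) i : ℝ) / 2 ^ M ≤
      ⨆ M' : ℕ, (S.cell M' (interval N M' x) i : ℝ) / 2 ^ M' :=
    le_ciSup (f := fun M' : ℕ => (S.cell M' (interval N M' x) i : ℝ) / 2 ^ M')
      ⟨_, by rintro _ ⟨M', rfl⟩; exact hle M'⟩ M
  have h2 := ciSup_le hle
  have h3 : S.curve x i = -1 / 2 +
    ⨆ M' : ℕ, (S.cell M' (interval N M' x) i : ℝ) / 2 ^ M' := rfl
  rw [h3]
  constructor <;> linarith

theorem curve_norm_sub_le (M : ℕ) {x x' : ℝ} (hx : 0 ≤ x) (hxx : x ≤ x')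
    (h : x' - x ≤ ((1 / 2) ^ N) ^ M) : ‖S.curve x - S.curve x'‖ ≤ √((N : ℝ) + 3) / 2 ^ M := by
  refine S.norm_sub_le_of_mem_box (interval_lt M x') ?_ (S.curve_mem_box M x) (S.curve_mem_box M x')
  have hK : (0 : ℝ) < 2 ^ (M * N) := by positivity
  have e : ((1 / 2 : ℝ) ^ N) ^ M * 2 ^ (M * N) = 1 := by
    rw [← pow_mul, mul_comm N M, ← mul_pow]
    norm_num
  have h1 : ⌊x * 2 ^ (M * N)⌋₊ ≤ ⌊x' * 2 ^ (M * N)⌋₊ := Nat.floor_mono (by gcongr)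
  have h2 : ⌊x' * 2 ^ (M * N)⌋₊ ≤ ⌊x * 2 ^ (M * N)⌋₊ + 1 := by
    rw [← Nat.floor_add_one (by positivity)]
    apply Nat.floor_mono
    nlinarith
  unfold interval
  omega

/-! ### The polygonal approximations -/

/-- The polygonal line in its natural parametrization. -/
noncomputable def path (d : ℕ) (t : ℝ) : EuclideanSpace ℝ (Fin N) :=
  S.center d ⌊t⌋₊ + (t - ⌊t⌋₊) • (S.center d (⌊t⌋₊ + 1) - S.center d ⌊t⌋₊)

theorem polygon_eq_path (d : ℕ) (x : ℝ) : S.polygon d x = S.path d (x * (2 ^ (d * N) - 1)) := rfl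

/-- A segment joining the centers of two adjacent subcubes crosses their common face at its
midpoint, so a point of it lies in the subcube of the nearer center. -/
theorem path_mem_box (d : ℕ) {t : ℝ} (ht : 0 ≤ t) (ht' : t ≤ 2 ^ (d * N) - 1) :
    S.path d t ∈ S.box d ⌊t + 1 / 2⌋₊ := by
  intro i
  set v := ⌊t⌋₊ with hv
  have hp : (0 : ℝ) < 2 ^ d := by positivity
  have f1 : (v : ℝ) ≤ t := Nat.floor_le ht
  have f2 : t < v + 1 := Nat.lt_floor_add_one t
  have hval : S.path d t i = -1 / 2 + ((S.cell d v i : ℝ) + 1 / 2) / 2 ^ d +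
      (t - v) * (((S.cell d (v + 1) i : ℝ) + 1 / 2) / 2 ^ d -
        ((S.cell d v i : ℝ) + 1 / 2) / 2 ^ d) := by
    simp [path, center, ← hv]
  have hval' : (S.path d t i + 1 / 2) * 2 ^ d = (S.cell d v i : ℝ) + 1 / 2 +
      (t - v) * ((S.cell d (v + 1) i : ℝ) - S.cell d v i) := by
    rw [hval]
    field_simp
    ring
  suffices h : (S.cell d ⌊t + 1 / 2⌋₊ i : ℝ) ≤ (S.path d t i + 1 / 2) * 2 ^ d ∧
      (S.path d t i + 1 / 2) * 2 ^ d ≤ (S.cell d ⌊t + 1 / 2⌋₊ i : ℝ) + 1 by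
    obtain ⟨h1, h2⟩ := h
    rw [← div_le_iff₀ hp] at h1
    rw [← le_div_iff₀ hp] at h2
    constructor <;> linarith
  rw [hval']
  -- At the last vertex the number v + 1 is out of range and its cell is arbitrary, but its
  -- coefficient t - v vanishes.
  by_cases hf : t = v
  · have hfl : ⌊t + 1 / 2⌋₊ = v := by
      rw [Nat.floor_eq_iff (by linarith)]
      constructor <;> linarith
    have : t - v = 0 := by linarith
    rw [hfl, this]
    constructor <;> linarith
  · have hv1 : v + 1 < 2 ^ (d * N) := by
      have h1 : (v : ℝ) < t := lt_of_le_of_ne f1 (Ne.symm hf)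
      have : (v : ℝ) + 1 < 2 ^ (d * N) := by linarith
      exact_mod_cast this
    have hdiff : |(S.cell d (v + 1) i : ℝ) - S.cell d v i| ≤ 1 := by
      obtain ⟨i₀, h0, hne⟩ := S.adjacent d v hv1
      by_cases hi : i = i₀
      · subst hi
        rcases h0 with h0 | h0 <;> rw [h0] <;> simp
      · simp [hne i hi]
    rw [abs_le] at hdiff
    by_cases hh : t - v < 1 / 2
    · have hfl : ⌊t + 1 / 2⌋₊ = v := by
        rw [Nat.floor_eq_iff (by linarith)]
        constructor <;> linarith
      rw [hfl]
      constructor <;> nlinarith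
    · have hfl : ⌊t + 1 / 2⌋₊ = v + 1 := by
        rw [Nat.floor_eq_iff (by linarith)]
        push_cast
        constructor <;> linarith
      rw [hfl]
      constructor <;> nlinarith

theorem norm_center_succ_sub_le (d v : ℕ) (hv : v + 1 < 2 ^ (d * N)) :
    ‖S.center d (v + 1) - S.center d v‖ ≤ 1 / 2 ^ d := by
  obtain ⟨i₀, h0, hne⟩ := S.adjacent d v hv
  have hz : S.center d (v + 1) - S.center d v =
      EuclideanSpace.single i₀ (((S.cell d (v + 1) i₀ : ℝ) - S.cell d v i₀) / 2 ^ d) := by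
    ext i
    by_cases hi : i = i₀
    · subst hi
      simp [center]
      ring
    · simp [center, hne i hi, hi]
  rw [hz, PiLp.norm_single, norm_div]
  have : ‖(S.cell d (v + 1) i₀ : ℝ) - S.cell d v i₀‖ = 1 := by
    rcases h0 with h0 | h0 <;> rw [h0] <;> simp
  rw [this]
  simp

theorem path_norm_sub_le (d : ℕ) {t u : ℝ} (ht : 0 ≤ t) (htu : t ≤ u) (htu' : u ≤ t + 1)
    (hu : u ≤ 2 ^ (d * N) - 1) : ‖S.path d t - S.path d u‖ ≤ (u - t) / 2 ^ d := by
  -- A zero coefficient needs no adjacency; this covers the nonexistent segment after the last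
  -- vertex.
  have key : ∀ v : ℕ, ∀ a : ℝ, 0 ≤ a → (a ≠ 0 → v + 1 < 2 ^ (d * N)) →
      ‖a • (S.center d (v + 1) - S.center d v)‖ ≤ a / 2 ^ d := by
    intro v a ha hv
    by_cases h0 : a = 0
    · simp [h0]
    · rw [norm_smul, Real.norm_of_nonneg ha, div_eq_mul_one_div]
      exact mul_le_mul_of_nonneg_left (S.norm_center_succ_sub_le d v (hv h0)) ha
  have f1 : (⌊t⌋₊ : ℝ) ≤ t := Nat.floor_le ht
  have f2 : t < ⌊t⌋₊ + 1 := Nat.lt_floor_add_one t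
  have g1 : (⌊u⌋₊ : ℝ) ≤ u := Nat.floor_le (ht.trans htu)
  have g2 : u < ⌊u⌋₊ + 1 := Nat.lt_floor_add_one u
  have h1 : ⌊t⌋₊ ≤ ⌊u⌋₊ := Nat.floor_mono htu
  have h2 : ⌊u⌋₊ ≤ ⌊t⌋₊ + 1 := by
    rw [← Nat.floor_add_one ht]
    exact Nat.floor_mono htu'
  rw [norm_sub_rev]
  obtain h | h : ⌊u⌋₊ = ⌊t⌋₊ ∨ ⌊u⌋₊ = ⌊t⌋₊ + 1 := by omega
  · have e : S.path d u - S.path d t = (u - t) • (S.center d (⌊t⌋₊ + 1) - S.center d ⌊t⌋₊) := by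
      simp only [path, h]
      module
    rw [e]
    refine key _ _ (by linarith) fun hne => ?_
    have : (⌊t⌋₊ : ℝ) + 1 < 2 ^ (d * N) := by
      have : t < u := lt_of_le_of_ne htu fun h => hne (by linarith)
      linarith
    exact_mod_cast this
  · have hc : (⌊u⌋₊ : ℝ) = ⌊t⌋₊ + 1 := by exact_mod_cast h
    have e : S.path d u - S.path d t =
        (⌊t⌋₊ + 1 - t) • (S.center d (⌊t⌋₊ + 1) - S.center d ⌊t⌋₊) +
        (u - ⌊u⌋₊) • (S.center d (⌊u⌋₊ + 1) - S.center d ⌊u⌋₊) := by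
      simp only [path, h]
      push_cast
      module
    rw [e]
    have k1 := key ⌊t⌋₊ (⌊t⌋₊ + 1 - t) (by linarith) fun _ => by
      have : (⌊t⌋₊ : ℝ) + 1 < 2 ^ (d * N) := by linarith
      exact_mod_cast this
    have k2 := key ⌊u⌋₊ (u - ⌊u⌋₊) (by linarith) fun hne => by
      have : (⌊u⌋₊ : ℝ) + 1 < 2 ^ (d * N) := by
        have : (⌊u⌋₊ : ℝ) < u := lt_of_le_of_ne g1 fun h => hne (by linarith)
        linarith
      exact_mod_cast this
    refine (norm_add_le _ _).trans ((add_le_add k1 k2).trans_eq ?_)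
    rw [← add_div, hc]
    congr 1
    ring

theorem floor_add_half_lt (d : ℕ) {t : ℝ} (ht : 0 ≤ t) (ht' : t ≤ 2 ^ (d * N) - 1) :
    ⌊t + 1 / 2⌋₊ < 2 ^ (d * N) := by
  rw [Nat.floor_lt (by linarith)]
  push_cast
  linarith

theorem polygon_param_mem (d : ℕ) {x : ℝ} (hx : x ∈ Set.Icc (0 : ℝ) 1) :
    0 ≤ x * (2 ^ (d * N) - 1) ∧ x * (2 ^ (d * N) - 1) ≤ (2 : ℝ) ^ (d * N) - 1 := by
  have : (1 : ℝ) ≤ 2 ^ (d * N) := one_le_pow₀ (by norm_num)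
  exact ⟨mul_nonneg hx.1 (by linarith), mul_le_of_le_one_left (by linarith) hx.2⟩

/-- Each point lies in a level-d subcube, hence in its level-M ancestor. The natural parameters
differ by at most 2^((d-M)N), the number of level-d descendants of one ancestor, so the ancestors
are equal or consecutive. -/
theorem polygon_norm_sub_le (d M : ℕ) (hM : M ≤ d) {x x' : ℝ} (hx : x ∈ Set.Icc (0 : ℝ) 1)
    (hx' : x' ∈ Set.Icc (0 : ℝ) 1) (hxx : x ≤ x') (h : x' - x ≤ ((1 / 2) ^ N) ^ M) :
    ‖S.polygon d x - S.polygon d x'‖ ≤ √((N : ℝ) + 3) / 2 ^ M := by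
  obtain ⟨e, rfl⟩ := Nat.exists_eq_add_of_le hM
  obtain ⟨a1, a2⟩ := polygon_param_mem (N := N) (M + e) hx
  obtain ⟨b1, b2⟩ := polygon_param_mem (N := N) (M + e) hx'
  rw [polygon_eq_path, polygon_eq_path]
  set t := x * (2 ^ ((M + e) * N) - 1) with ht
  set u := x' * (2 ^ ((M + e) * N) - 1) with hu
  have lt1 := floor_add_half_lt _ a1 a2
  have lt2 := floor_add_half_lt _ b1 b2
  have hB : (0 : ℝ) < 2 ^ (e * N) := by positivity
  have hK : (1 : ℝ) ≤ 2 ^ ((M + e) * N) := one_le_pow₀ (by norm_num)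
  have fdiv : ∀ s : ℝ, ⌊s + 1 / 2⌋₊ / 2 ^ (e * N) = ⌊(s + 1 / 2) / 2 ^ (e * N)⌋₊ := by
    intro s
    have := Nat.floor_div_natCast (s + 1 / 2) (2 ^ (e * N))
    rw [← this]
    push_cast
    rfl
  refine S.norm_sub_le_of_mem_box ?_ ?_ (S.box_add_subset e lt1 (S.path_mem_box _ a1 a2))
    (S.box_add_subset e lt2 (S.path_mem_box _ b1 b2))
  · apply Nat.div_lt_of_lt_mul
    rw [← pow_add]
    convert lt2 using 2
    ring
  · have htu : t ≤ u := by
      rw [ht, hu]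
      exact mul_le_mul_of_nonneg_right hxx (by linarith)
    have hdiff : u - t ≤ 2 ^ (e * N) := by
      have e1 : u - t = (x' - x) * (2 ^ ((M + e) * N) - 1) := by rw [ht, hu]; ring
      have e2 : ((1 / 2 : ℝ) ^ N) ^ M * 2 ^ ((M + e) * N) = 2 ^ (e * N) := by
        rw [← pow_mul, mul_comm N M, add_mul, pow_add, ← mul_assoc, ← mul_pow]
        norm_num
      rw [e1, ← e2]
      refine mul_le_mul h (by linarith) (by linarith) (by positivity)
    have m1 : ⌊(t + 1 / 2) / 2 ^ (e * N)⌋₊ ≤ ⌊(u + 1 / 2) / 2 ^ (e * N)⌋₊ :=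
      Nat.floor_mono (by gcongr)
    have m2 : ⌊(u + 1 / 2) / 2 ^ (e * N)⌋₊ ≤ ⌊(t + 1 / 2) / 2 ^ (e * N)⌋₊ + 1 := by
      rw [← Nat.floor_add_one (by positivity)]
      apply Nat.floor_mono
      rw [div_add_one hB.ne']
      exact (div_le_div_iff_of_pos_right hB).2 (by linarith)
    rw [fdiv, fdiv]
    omega

theorem curve_mem_searchCube (x : ℝ) : S.curve x ∈ searchCube N :=
  S.box_subset_searchCube (interval_lt 0 x) (S.curve_mem_box 0 x)

theorem polygon_mem_searchCube (d : ℕ) {x : ℝ} (hx : x ∈ Set.Icc (0 : ℝ) 1) :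
    S.polygon d x ∈ searchCube N := by
  obtain ⟨a1, a2⟩ := polygon_param_mem (N := N) d hx
  exact S.box_subset_searchCube (floor_add_half_lt d a1 a2) (S.path_mem_box d a1 a2)

/-- The Peano curve and its approximations satisfy a Hölder condition with exponent `1 / N`. -/
theorem holder (hN : 1 ≤ N) {γ : ℝ → EuclideanSpace ℝ (Fin N)}
    (hγ : γ = S.curve ∨ ∃ d, γ = S.polygon d) {x x' : ℝ} (hx : x ∈ Set.Icc (0 : ℝ) 1)
    (hx' : x' ∈ Set.Icc (0 : ℝ) 1) :
    ‖γ x - γ x'‖ ≤ 2 * √((N : ℝ) + 3) * |x - x'| ^ (1 / (N : ℝ)) := by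
  wlog hlt : x < x' generalizing x x'
  · rcases (not_lt.1 hlt).eq_or_lt with h | h
    · subst h
      simp only [sub_self, norm_zero]
      positivity
    · rw [norm_sub_rev, abs_sub_comm]
      exact this hx' hx h
  rw [abs_sub_comm, abs_of_pos (sub_pos.2 hlt)]
  have hs0 : 0 < x' - x := sub_pos.2 hlt
  have hs1 : x' - x ≤ 1 := by linarith [hx.1, hx'.2]
  have hN0 : N ≠ 0 := by omega
  -- 2^(-(M+1)N) < x' - x ≤ 2^(-MN): the upper bound controls the subcubes, and the lower one costs
  -- the factor 2 in the constant.
  obtain ⟨M, hM1, hM2⟩ := exists_nat_pow_near_of_lt_one hs0 hs1 (y := (1 / 2 : ℝ) ^ N)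
    (by positivity) (pow_lt_one₀ (by norm_num) (by norm_num) hN0)
  have root : ∀ n : ℕ, (((1 / 2 : ℝ) ^ N) ^ n) ^ (1 / (N : ℝ)) = (1 / 2) ^ n := by
    intro n
    rw [← pow_mul, mul_comm N n, pow_mul, one_div (N : ℝ),
      Real.pow_rpow_inv_natCast (by positivity) hN0]
  have hroot : (1 / 2 : ℝ) ^ (M + 1) ≤ (x' - x) ^ (1 / (N : ℝ)) := by
    rw [← root]
    exact Real.rpow_le_rpow (by positivity) hM1.le (by positivity)
  have hfin : √((N : ℝ) + 3) / 2 ^ M ≤ 2 * √((N : ℝ) + 3) * (x' - x) ^ (1 / (N : ℝ)) := by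
    have e : √((N : ℝ) + 3) / 2 ^ M = 2 * √((N : ℝ) + 3) * (1 / 2) ^ (M + 1) := by
      rw [pow_succ, one_div_pow]
      ring
    rw [e]
    gcongr
  rcases hγ with rfl | ⟨d, rfl⟩
  · exact (S.curve_norm_sub_le M hx.1 hlt.le hM2).trans hfin
  · by_cases hMd : M ≤ d
    · exact (S.polygon_norm_sub_le d M hMd hx hx' hlt.le hM2).trans hfin
    -- Below the resolution of the polygon there are no finer subcubes, but its speed is bounded.
    -- With s = (x' - x)·2^(dN) ≤ 1 the distance is at most s/2^d ≤ s^(1/N)/2^d = (x' - x)^(1/N).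
    · obtain ⟨a1, a2⟩ := polygon_param_mem (N := N) d hx
      obtain ⟨b1, b2⟩ := polygon_param_mem (N := N) d hx'
      have hK : (1 : ℝ) ≤ 2 ^ (d * N) := one_le_pow₀ (by norm_num)
      have hle : (x' - x) * 2 ^ (d * N) ≤ 1 := by
        have h1 : ((1 / 2 : ℝ) ^ N) ^ M ≤ ((1 / 2 : ℝ) ^ N) ^ d :=
          pow_le_pow_of_le_one (by positivity) (pow_le_one₀ (by norm_num) (by norm_num))
            (by omega)
        calc (x' - x) * 2 ^ (d * N) ≤ ((1 / 2 : ℝ) ^ N) ^ d * 2 ^ (d * N) := by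
              gcongr; exact hM2.trans h1
          _ = 1 := by
              rw [← pow_mul, mul_comm N d, ← mul_pow]
              norm_num
      rw [polygon_eq_path, polygon_eq_path]
      have hp := S.path_norm_sub_le d a1 (mul_le_mul_of_nonneg_right hlt.le (by linarith))
        (by nlinarith) b2
      refine hp.trans ?_
      have hpos : 0 < (x' - x) * 2 ^ (d * N) := by positivity
      have h1 : x' * (2 ^ (d * N) - 1) - x * (2 ^ (d * N) - 1) ≤ (x' - x) * 2 ^ (d * N) := by
        nlinarith
      have h2 : (x' - x) * 2 ^ (d * N) ≤ ((x' - x) * 2 ^ (d * N)) ^ (1 / (N : ℝ)) := by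
        refine Real.self_le_rpow_of_le_one hpos.le hle ?_
        rw [div_le_one (by positivity)]
        exact_mod_cast hN
      have h3 : ((x' - x) * 2 ^ (d * N)) ^ (1 / (N : ℝ)) = (x' - x) ^ (1 / (N : ℝ)) * 2 ^ d := by
        rw [Real.mul_rpow hs0.le (by positivity), pow_mul, one_div,
          Real.pow_rpow_inv_natCast (by positivity) hN0]
      rw [div_le_iff₀ (by positivity)]
      refine (h1.trans (h2.trans_eq h3)).trans ?_
      have h4 : 1 ≤ 2 * √((N : ℝ) + 3) := by
        have : 1 ≤ √((N : ℝ) + 3) := Real.one_le_sqrt.2 (by linarith [Nat.cast_nonneg (α := ℝ) N])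
        linarith
      have h5 : 0 ≤ (x' - x) ^ (1 / (N : ℝ)) * 2 ^ d := by positivity
      nlinarith

end PeanoOrder

/-! ### Indices, values and solutions -/

section Reduction

variable {m : ℕ} (g : Fin (m + 1) → ℝ → ℝ)

theorem le_zero_of_lt_index {x : ℝ} {i : Fin (m + 1)} (hi : i < index g x) : g i x ≤ 0 := by
  classical
  by_contra! h
  exact absurd hi (not_lt.2 (Finset.min'_le _ _ (by simp [h])))

theorem index_eq_last_or_pos (x : ℝ) : index g x = Fin.last m ∨ 0 < g (index g x) x := by
  unfold index
  generalize_proofs hp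
  exact (Finset.mem_filter.1 (Finset.min'_mem _ hp)).2

theorem mem_reducedRegion_index {x : ℝ} (hx : x ∈ Set.Icc (0 : ℝ) 1) :
    x ∈ reducedRegion g (index g x) :=
  ⟨hx, fun _ hj => le_zero_of_lt_index g hj⟩

theorem index_eq_last_of_mem {x : ℝ} (hx : x ∈ reducedRegion g (Fin.last m)) :
    index g x = Fin.last m := by
  rcases index_eq_last_or_pos g x with h | h
  · exact h
  · by_contra hne
    exact absurd h (not_lt.2 (hx.2 _ (lt_of_le_of_ne (Fin.le_last _) hne)))

/-- The reduced functions satisfy the Hölder condition with exponent `1 / N` on their domains. -/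
def HolderOn (N : ℕ) (H : ℝ) : Prop :=
  ∀ i, ∀ x ∈ reducedRegion g i, ∀ x' ∈ reducedRegion g i,
    |g i x - g i x'| ≤ H * |x - x'| ^ (1 / (N : ℝ))

variable {g} {N : ℕ} {H : ℝ}

/-- A solution of the unconstrained problem solves the constrained one. -/
theorem IsSolution.spec (hne : (reducedRegion g (Fin.last m)).Nonempty) {xs : ℝ} (hxs : IsSolution g xs) :
    xs ∈ reducedRegion g (Fin.last m) ∧
      ∀ x ∈ reducedRegion g (Fin.last m), g (Fin.last m) xs ≤ g (Fin.last m) x := by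
  have hidx : index g xs = Fin.last m := by
    rcases index_eq_last_or_pos g xs with h | h
    · exact h
    · by_contra hlt
      -- An infeasible minimizer would have Φ > 0, whereas feasible points make Φ smaller than any
      -- given positive number.
      obtain ⟨_, ⟨x, hx, rfl⟩, hlt'⟩ := exists_lt_of_csInf_lt (hne.image (g (Fin.last m)))
        (lt_add_of_pos_right (optValue g) h)
      have h2 := hxs.2 x hx.1
      simp only [auxFun, index_eq_last_of_mem g hx, hlt, if_true, if_false] at h2
      linarith
  refine ⟨hidx ▸ mem_reducedRegion_index g hxs.1, fun x hx => ?_⟩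
  have h2 := hxs.2 x hx.1
  simp only [auxFun, index_eq_last_of_mem g hx, hidx, if_true] at h2
  linarith

theorem zAt_nonneg (T : Finset ℝ) {x : ℝ} (hx : x ∈ T) : 0 ≤ zAt g T x := by
  unfold zAt
  split_ifs with h
  · have hfin : (g (Fin.last m) '' {x | x ∈ T ∧ index g x = Fin.last m}).Finite :=
      (T.finite_toSet.subset fun _ h => h.1).image _
    have : bestValue g T ≤ g (Fin.last m) x := csInf_le hfin.bddBelow ⟨x, ⟨hx, h⟩, rfl⟩
    rw [h]
    linarith
  · have := (index_eq_last_or_pos g x).resolve_left h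
    linarith

/-- A feasible xs lies in the domain of every g_i. For a violated constraint g_ν(xs) ≤ 0; for the
objective g(xs) is at most the best value found. So z(x) ≤ g_ν(x) - g_ν(xs) in either case. -/
theorem zAt_le (hg : HolderOn g N H) {T : Finset ℝ} (hT : ∀ x ∈ T, x ∈ Set.Icc (0 : ℝ) 1)
    {xs : ℝ} (hxs : xs ∈ reducedRegion g (Fin.last m))
    (hmin : ∀ x ∈ reducedRegion g (Fin.last m), g (Fin.last m) xs ≤ g (Fin.last m) x)
    {x : ℝ} (hx : x ∈ T) : zAt g T x ≤ H * |x - xs| ^ (1 / (N : ℝ)) := by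
  have hreg := mem_reducedRegion_index g (hT x hx)
  have hxs' : xs ∈ reducedRegion g (index g x) :=
    ⟨hxs.1, fun j hj => hxs.2 j (hj.trans_le (Fin.le_last _))⟩
  refine le_trans ?_ (le_trans (le_abs_self _) (hg _ x hreg xs hxs'))
  unfold zAt
  split_ifs with h
  · have : g (Fin.last m) xs ≤ bestValue g T := by
      refine le_csInf ⟨_, x, ⟨hx, h⟩, rfl⟩ ?_
      rintro _ ⟨y, ⟨hy, hyi⟩, rfl⟩
      exact hmin y (hyi ▸ mem_reducedRegion_index g (hT y hy))
    rw [h]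
    linarith
  · have := hxs.2 _ (lt_of_le_of_ne (Fin.le_last _) h)
    linarith

end Reduction

/-! ### The trial points in increasing order -/

theorem point_eq (T : Finset ℝ) {i : ℕ} (hi : i < T.card) :
    point T i = (T.sort (· ≤ ·))[i]'(by simpa using hi) := by
  simp [point, hi]

theorem point_mem (T : Finset ℝ) {i : ℕ} (hi : i < T.card) : point T i ∈ T := by
  rw [point_eq T hi]
  exact (Finset.mem_sort (· ≤ ·)).1 (List.getElem_mem _)

theorem point_lt (T : Finset ℝ) {i j : ℕ} (hij : i < j) (hj : j < T.card) :
    point T i < point T j := by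
  rw [point_eq T hj, point_eq T (hij.trans hj)]
  exact (Finset.sortedLT_sort T).strictMono_get (a := ⟨i, by simp; omega⟩) (b := ⟨j, by simpa⟩) hij

theorem exists_point_eq (T : Finset ℝ) {x : ℝ} (hx : x ∈ T) : ∃ i < T.card, point T i = x := by
  obtain ⟨i, hi, h⟩ := List.getElem_of_mem ((Finset.mem_sort (· ≤ ·)).2 hx)
  have hi' : i < T.card := by simpa using hi
  exact ⟨i, hi', by rw [← h, point_eq T hi']⟩

/-- No element of `T` lies strictly between two consecutive ones. -/
theorem le_point_or_point_le (T : Finset ℝ) {j : ℕ} (hj : j < T.card) {x : ℝ} (hx : x ∈ T) :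
    x ≤ point T (j - 1) ∨ point T j ≤ x := by
  obtain ⟨i, hi, rfl⟩ := exists_point_eq T hx
  rcases lt_or_ge i j with h | h
  · left
    rcases (Nat.le_sub_one_of_lt h).eq_or_lt with h' | h'
    · rw [h']
    · exact (point_lt T h' (by omega)).le
  · right
    rcases h.eq_or_lt with h' | h'
    · rw [h']
    · exact (point_lt T h' hi).le

theorem exists_mem_interval (T : Finset ℝ) (h0 : (0 : ℝ) ∈ T) (h1 : (1 : ℝ) ∈ T) {x : ℝ}
    (hx : x ∈ Set.Icc (0 : ℝ) 1) :
    ∃ j, 1 ≤ j ∧ j ≤ T.card - 1 ∧ x ∈ Set.Icc (point T (j - 1)) (point T j) := by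
  classical
  obtain ⟨i₁, hi₁, e₁⟩ := exists_point_eq T h1
  obtain ⟨i₀, hi₀, e₀⟩ := exists_point_eq T h0
  have hi : i₀ < i₁ := by
    by_contra! h
    rcases h.eq_or_lt with h | h
    · rw [h, e₀] at e₁
      norm_num at e₁
    · have := point_lt T h hi₀
      rw [e₀, e₁] at this
      norm_num at this
  have hex : ∃ j, 1 ≤ j ∧ j < T.card ∧ x ≤ point T j := ⟨i₁, by omega, hi₁, e₁ ▸ hx.2⟩
  -- The first point with number at least 1 not below x is the right end: by minimality the
  -- preceding point is not above x.
  obtain ⟨a, b, c⟩ := Nat.find_spec hex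
  refine ⟨Nat.find hex, a, by omega, ?_, c⟩
  by_contra! hlt
  by_cases h2 : Nat.find hex - 1 = 0
  · rw [h2] at hlt
    have hle : point T 0 ≤ 0 := by
      rcases Nat.eq_zero_or_pos i₀ with h | h
      · rw [← h, e₀]
      · exact e₀ ▸ (point_lt T h hi₀).le
    linarith [hx.1]
  · exact Nat.find_min hex (m := Nat.find hex - 1) (by omega) ⟨by omega, by omega, hlt.le⟩

/-- Concavity of t^(1/N) at the midpoint of a and b; the source of the factor 2^(1-1/N). -/
theorem rpow_add_rpow_le {N : ℕ} (hN : 1 ≤ N) {a b : ℝ} (ha : 0 ≤ a) (hb : 0 ≤ b) :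
    a ^ (1 / (N : ℝ)) + b ^ (1 / (N : ℝ)) ≤
      2 ^ (1 - 1 / (N : ℝ)) * (a + b) ^ (1 / (N : ℝ)) := by
  have hN' : (1 : ℝ) ≤ N := by exact_mod_cast hN
  have h := @(Real.concaveOn_rpow (p := 1 / (N : ℝ)) (by positivity)
    ((div_le_one (by positivity)).2 hN')).2 a (Set.mem_Ici.2 ha) b (Set.mem_Ici.2 hb)
    (1 / 2) (1 / 2) (by norm_num) (by norm_num) (by norm_num)
  simp only [smul_eq_mul] at h
  rw [← mul_add, ← mul_add, one_div_mul_eq_div, one_div_mul_eq_div,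
    Real.div_rpow (by positivity) (by norm_num)] at h
  rw [Real.rpow_sub (by norm_num), Real.rpow_one]
  rw [div_le_iff₀ (by norm_num)] at h
  refine h.trans_eq ?_
  ring

/-! ### Characteristics of intervals and new trial points -/

section Algorithm

variable {N m : ℕ} {g : Fin (m + 1) → ℝ → ℝ} {ξ r : ℝ} {T : Finset ℝ}

/-- The proof needs only two facts about the local estimate: this bound and `hquot_le_mEst`. -/
theorem xi_le_mEst (i : ℕ) : ξ ≤ mEst N g ξ T i := le_max_right _ _

theorem hquot_le_mEst {i : ℕ} (h : nu g T i = nu g T (i - 1)) :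
    hquot N g T i ≤ mEst N g ξ T i := by
  have : cEst N g T i = hquot N g T i := by simp [cEst, h]
  rw [← this]
  exact ((le_max_right _ _).trans (le_max_left _ _)).trans
    ((le_max_left _ _).trans (le_max_left _ _))

theorem hlen_pos {i : ℕ} (hi : 1 ≤ i) (hi' : i < T.card) : 0 < hlen N T i :=
  Real.rpow_pos_of_pos (sub_pos.2 (point_lt T (by omega) hi')) _

theorem hlen_pow (hN : 1 ≤ N) {i : ℕ} (hi : 1 ≤ i) (hi' : i < T.card) :
    hlen N T i ^ N = point T i - point T (i - 1) := by
  unfold hlen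
  rw [one_div, Real.rpow_inv_natCast_pow (sub_pos.2 (point_lt T (by omega) hi')).le (by omega)]

theorem zval_nonneg {i : ℕ} (hi : i < T.card) : 0 ≤ zval g T i := zAt_nonneg T (point_mem T hi)

theorem abs_zval_sub_le {i : ℕ} (hi : 1 ≤ i) (hi' : i < T.card)
    (h : nu g T i = nu g T (i - 1)) :
    |zval g T i - zval g T (i - 1)| ≤ mEst N g ξ T i * hlen N T i :=
  (div_le_iff₀ (hlen_pos hi hi')).1 (hquot_le_mEst h)

/-- The quadratic term is at most Δ_i because |z_i - z_(i-1)| ≤ M_i Δ_i, and the remaining terms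
only lower R_i because z ≥ 0. Thus a large characteristic forces a long interval. -/
theorem charac_le (hξ : 0 < ξ) (hr : 1 < r) {i : ℕ} (hi : 1 ≤ i) (hi' : i < T.card) :
    charac N g ξ r T i ≤ 2 * hlen N T i := by
  have hM : 0 < mEst N g ξ T i := hξ.trans_le (xi_le_mEst i)
  have hrM : 0 < r * mEst N g ξ T i := by positivity
  have hΔ := hlen_pos (N := N) hi hi'
  have z1 := zval_nonneg (g := g) hi'
  have z0 := zval_nonneg (g := g) (T := T) (i := i - 1) (by omega)
  unfold charac
  split_ifs with h h'
  · have h1 := abs_zval_sub_le (N := N) (ξ := ξ) hi hi' h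
    have h2 : (zval g T i - zval g T (i - 1)) ^ 2 ≤ (r * mEst N g ξ T i) ^ 2 * hlen N T i ^ 2 := by
      rw [← sq_abs, ← mul_pow]
      refine pow_le_pow_left₀ (abs_nonneg _) (h1.trans ?_) 2
      have : 0 < mEst N g ξ T i * hlen N T i := by positivity
      nlinarith
    have h3 : (zval g T i - zval g T (i - 1)) ^ 2 / ((r * mEst N g ξ T i) ^ 2 * hlen N T i) ≤
        hlen N T i := by
      rw [div_le_iff₀ (by positivity)]
      refine h2.trans_eq ?_
      ring
    have h4 : 0 ≤ 2 * (zval g T i + zval g T (i - 1)) / (r * mEst N g ξ T i) := by positivity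
    linarith
  · have : 0 ≤ 4 * zval g T i / (r * mEst N g ξ T i) := by positivity
    linarith
  · have : 0 ≤ 4 * zval g T (i - 1) / (r * mEst N g ξ T i) := by positivity
    linarith

/-- The new trial point divides its interval in a bounded ratio. -/
theorem newPoint_mem (hN : 1 ≤ N) (hξ : 0 < ξ) (hr : 1 < r) {i : ℕ} (hi : 1 ≤ i)
    (hi' : i < T.card) :
    point T (i - 1) + (1 - 1 / r) / 2 * (point T i - point T (i - 1)) ≤ newPoint N g ξ r T i ∧
      newPoint N g ξ r T i ≤ point T i - (1 - 1 / r) / 2 * (point T i - point T (i - 1)) := by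
  have hM : 0 < mEst N g ξ T i := hξ.trans_le (xi_le_mEst i)
  have hlt : 0 < point T i - point T (i - 1) := sub_pos.2 (point_lt T (by omega) hi')
  have hr0 : 0 < r := by linarith
  unfold newPoint
  split_ifs with h
  · have h1 := pow_le_pow_left₀ (abs_nonneg _) (abs_zval_sub_le (N := N) (ξ := ξ) hi hi' h) N
    rw [mul_pow, hlen_pow hN hi hi'] at h1
    have h2 : |zval g T i - zval g T (i - 1)| ^ N / (2 * r * mEst N g ξ T i ^ N) ≤
        1 / r / 2 * (point T i - point T (i - 1)) := by
      rw [div_le_iff₀ (by positivity)]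
      refine h1.trans_eq ?_
      field_simp
    have h3 : 0 ≤ |zval g T i - zval g T (i - 1)| ^ N / (2 * r * mEst N g ξ T i ^ N) := by
      positivity
    rw [mul_div_assoc]
    rcases Real.sign_apply_eq (zval g T i - zval g T (i - 1)) with hs | hs | hs <;> rw [hs] <;>
      constructor <;> linarith
  · have h2 : 0 ≤ 1 / r * (point T i - point T (i - 1)) := by positivity
    constructor <;> linarith

theorem le_dist_newPoint (hN : 1 ≤ N) (hξ : 0 < ξ) (hr : 1 < r) {i : ℕ} (hi : 1 ≤ i)
    (hi' : i < T.card) {x : ℝ} (hx : x ∈ T) :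
    (1 - 1 / r) / 2 * (point T i - point T (i - 1)) ≤ |newPoint N g ξ r T i - x| := by
  obtain ⟨h1, h2⟩ := newPoint_mem (N := N) (g := g) hN hξ hr hi hi'
  rcases le_point_or_point_le T hi' hx with h | h
  · exact le_trans (by linarith) (le_abs_self _)
  · exact le_trans (by linarith) (neg_le_abs _)

theorem bestInterval_spec (hT : 2 ≤ T.card) :
    1 ≤ bestInterval N g ξ r T ∧ bestInterval N g ξ r T < T.card ∧
      ∀ j, 1 ≤ j → j ≤ T.card - 1 → charac N g ξ r T j ≤
        charac N g ξ r T (bestInterval N g ξ r T) := by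
  obtain ⟨i, hi, hmax⟩ := Finset.exists_max_image (Finset.Icc 1 (T.card - 1))
    (charac N g ξ r T) ⟨1, by simp; omega⟩
  rw [Finset.mem_Icc] at hi
  obtain ⟨a, b, c⟩ := Nat.sInf_mem (s := {i | 1 ≤ i ∧ i ≤ T.card - 1 ∧
    ∀ j, 1 ≤ j → j ≤ T.card - 1 → charac N g ξ r T j ≤ charac N g ξ r T i})
    ⟨i, hi.1, hi.2, fun j h1 h2 => hmax j (Finset.mem_Icc.2 ⟨h1, h2⟩)⟩
  exact ⟨a, lt_of_le_of_lt b (by omega), c⟩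

/-! ### The trial sets -/

/-- The positive margin in `le_dist_newPoint` keeps the new point off all old ones, so each
iteration adds exactly one point and `T.card - 1` is the true number of intervals. -/
theorem trialSet_spec (hN : 1 ≤ N) (hξ : 0 < ξ) (hr : 1 < r) (k : ℕ) :
    (trialSet N g ξ r (k + 1)).card = k + 2 ∧ 0 ∈ trialSet N g ξ r (k + 1) ∧
      1 ∈ trialSet N g ξ r (k + 1) ∧ ∀ x ∈ trialSet N g ξ r (k + 1), x ∈ Set.Icc (0 : ℝ) 1 := by
  induction k with
  | zero =>
    refine ⟨by simp [trialSet], by simp [trialSet], by simp [trialSet], fun x hx => ?_⟩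
    have : x = 0 ∨ x = 1 := by simpa [trialSet] using hx
    rcases this with rfl | rfl <;> simp
  | succ k ih =>
    obtain ⟨hc, h0, h1, hI⟩ := ih
    rw [trialSet]
    set T := trialSet N g ξ r (k + 1) with hT
    obtain ⟨b1, b2, -⟩ := bestInterval_spec (N := N) (g := g) (ξ := ξ) (r := r) (T := T) (by omega)
    set t := bestInterval N g ξ r T
    have hlt := sub_pos.2 (point_lt T (show t - 1 < t by omega) b2)
    have hr' : 0 < (1 - 1 / r) / 2 := by
      have : 1 / r < 1 := (div_lt_one (by linarith)).2 hr
      linarith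
    have hpos := mul_pos hr' hlt
    obtain ⟨n1, n2⟩ := newPoint_mem (N := N) (g := g) hN hξ hr b1 b2
    have hnot : newPoint N g ξ r T t ∉ T := fun h => by
      have := le_dist_newPoint (N := N) (g := g) hN hξ hr b1 b2 h
      rw [sub_self, abs_zero] at this
      linarith
    refine ⟨by rw [Finset.card_insert_of_notMem hnot, hc], Finset.mem_insert_of_mem h0,
      Finset.mem_insert_of_mem h1, fun x hx => ?_⟩
    rcases Finset.mem_insert.1 hx with rfl | hx
    · have p1 := (hI _ (point_mem T b2)).2
      have p0 := (hI _ (point_mem T (show t - 1 < T.card by omega))).1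
      constructor <;> linarith
    · exact hI x hx

theorem mem_trialSet_iff {k : ℕ} {x : ℝ} :
    x ∈ trialSet N g ξ r k ↔ ∃ n ≤ k, trial N g ξ r n = x := by
  induction k with
  | zero => simp [trialSet, trial, eq_comm]
  | succ k ih =>
    have : x ∈ trialSet N g ξ r (k + 1) ↔
        x ∈ trialSet N g ξ r k ∨ trial N g ξ r (k + 1) = x := by
      cases k with
      | zero => simp [trialSet, trial, eq_comm]
      | succ k => rw [trialSet, Finset.mem_insert, trial, or_comm, eq_comm]
    rw [this, ih]
    constructor
    · rintro (⟨n, hn, h⟩ | h)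
      · exact ⟨n, by omega, h⟩
      · exact ⟨k + 1, le_rfl, h⟩
    · rintro ⟨n, hn, h⟩
      rcases Nat.lt_or_ge k n with h' | h'
      · obtain rfl : n = k + 1 := by omega
        exact Or.inr h
      · exact Or.inl ⟨n, h', h⟩

/-! ### The interval of a solution -/

variable {H : ℝ}

theorem zval_le_left {xs : ℝ} (hz : ∀ x ∈ T, zAt g T x ≤ H * |x - xs| ^ (1 / (N : ℝ)))
    {j : ℕ} (hj' : j < T.card) (hxs : xs ∈ Set.Icc (point T (j - 1)) (point T j)) :
    zval g T (j - 1) ≤ H * (xs - point T (j - 1)) ^ (1 / (N : ℝ)) := by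
  have := hz _ (point_mem T (i := j - 1) (by omega))
  rwa [abs_sub_comm, abs_of_nonneg (sub_nonneg.2 hxs.1)] at this

theorem zval_le_right {xs : ℝ} (hz : ∀ x ∈ T, zAt g T x ≤ H * |x - xs| ^ (1 / (N : ℝ)))
    {j : ℕ} (hj' : j < T.card) (hxs : xs ∈ Set.Icc (point T (j - 1)) (point T j)) :
    zval g T j ≤ H * (point T j - xs) ^ (1 / (N : ℝ)) := by
  have := hz _ (point_mem T hj')
  rwa [abs_of_nonneg (sub_nonneg.2 hxs.2)] at this

theorem one_le_two_rpow (hN : 1 ≤ N) : (1 : ℝ) ≤ 2 ^ (1 - 1 / (N : ℝ)) := by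
  have hN' : (1 : ℝ) ≤ N := by exact_mod_cast hN
  refine Real.one_le_rpow (by norm_num) ?_
  rw [sub_nonneg]
  exact (div_le_one (by positivity)).2 hN'

/-- Both quotients are at most H, so C_j ≤ H. For equal indices D_j ≤ C_j ≤ q C_j with q =
2^(1-1/N); hence the radicand is nonnegative, its root is at most q C_j, and the left side is at
most 2qH. -/
theorem convCondition_of_lt (hN : 1 ≤ N) (hH : 0 ≤ H) {xs : ℝ}
    (hz : ∀ x ∈ T, zAt g T x ≤ H * |x - xs| ^ (1 / (N : ℝ)))
    {j : ℕ} (hj : 1 ≤ j) (hj' : j < T.card) (hxs : xs ∈ Set.Icc (point T (j - 1)) (point T j))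
    (hlt : 2 * (2 ^ (1 - 1 / (N : ℝ)) * H) < r * mEst N g ξ T j) :
    ConvCondition N g ξ r T xs j := by
  have zl := zval_le_left hz hj' hxs
  have zr := zval_le_right hz hj' hxs
  have z1 := zval_nonneg (g := g) hj'
  have z0 := zval_nonneg (g := g) (T := T) (i := j - 1) (by omega)
  have d0 := sub_nonneg.2 hxs.1
  have d1 := sub_nonneg.2 hxs.2
  have hp : (0 : ℝ) < 1 / N := by positivity
  set p := 1 / (N : ℝ) with hpdef
  have hone : (1 : ℝ) ≤ 2 ^ (1 - p) := one_le_two_rpow hN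
  set a := zval g T (j - 1) / (xs - point T (j - 1)) ^ p with ha
  set b := zval g T j / (point T j - xs) ^ p with hb
  have a0 : 0 ≤ a := by positivity
  have b0 : 0 ≤ b := by positivity
  have aH : a ≤ H := div_le_of_le_mul₀ (by positivity) hH zl
  have bH : b ≤ H := div_le_of_le_mul₀ (by positivity) hH zr
  -- If xs is the end point, `zl` forces z = 0, so reading 0 / 0 as 0 is harmless.
  have za : zval g T (j - 1) = a * (xs - point T (j - 1)) ^ p := by
    rcases d0.eq_or_lt with h | h
    · rw [← h, Real.zero_rpow hp.ne'] at zl ⊢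
      linarith
    · rw [ha, div_mul_cancel₀ _ (Real.rpow_pos_of_pos h p).ne']
  have zb : zval g T j = b * (point T j - xs) ^ p := by
    rcases d1.eq_or_lt with h | h
    · rw [← h, Real.zero_rpow hp.ne'] at zr ⊢
      linarith
    · rw [hb, div_mul_cancel₀ _ (Real.rpow_pos_of_pos h p).ne']
  have hC0 : 0 ≤ cVal N g T xs j := by
    simp only [cVal]
    split_ifs
    · exact a0
    · exact b0
    · exact a0.trans (le_max_left _ _)
  have hCH : cVal N g T xs j ≤ H := by
    simp only [cVal]
    split_ifs
    · exact aH
    · exact bH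
    · exact max_le aH bH
  unfold ConvCondition
  split_ifs with h
  · have hCeq : cVal N g T xs j = max a b := by
      simp [cVal, h, ha, hb, hpdef]
    have hΔ := hlen_pos (N := N) hj hj'
    have hD : dVal N g T j ≤ cVal N g T xs j := by
      have l1 : (xs - point T (j - 1)) ^ p ≤ hlen N T j :=
        Real.rpow_le_rpow d0 (by linarith) hp.le
      have l2 : (point T j - xs) ^ p ≤ hlen N T j := Real.rpow_le_rpow d1 (by linarith) hp.le
      -- Both values lie between 0 and max(a, b)·Δ_j, so their difference is no larger in absolute
      -- value.
      rw [dVal, if_pos h, hquot, div_le_iff₀ hΔ, hCeq, abs_le]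
      have e1 : zval g T (j - 1) ≤ max a b * hlen N T j := by
        rw [za]
        exact mul_le_mul (le_max_left _ _) l1 (by positivity) (a0.trans (le_max_left _ _))
      have e2 : zval g T j ≤ max a b * hlen N T j := by
        rw [zb]
        exact mul_le_mul (le_max_right _ _) l2 (by positivity) (a0.trans (le_max_left _ _))
      constructor <;> linarith
    have hD0 : 0 ≤ dVal N g T j := by
      rw [dVal, if_pos h, hquot]
      positivity
    have hsq : (2 : ℝ) ^ (2 - 2 / (N : ℝ)) = (2 ^ (1 - p)) ^ 2 := by
      rw [← Real.rpow_natCast, ← Real.rpow_mul (by norm_num), hpdef]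
      congr 1
      push_cast
      ring
    rw [hsq, ← mul_pow]
    set C := cVal N g T xs j
    set q := (2 : ℝ) ^ (1 - p)
    have hCq : C ≤ q * C := le_mul_of_one_le_left hC0 hone
    have hqH : q * C ≤ q * H := mul_le_mul_of_nonneg_left hCH (by linarith)
    refine ⟨sub_nonneg.2 (pow_le_pow_left₀ hD0 (hD.trans hCq) 2), ?_⟩
    have hs : √((q * C) ^ 2 - dVal N g T j ^ 2) ≤ q * C :=
      Real.sqrt_le_iff.2 ⟨by linarith, by linarith [sq_nonneg (dVal N g T j)]⟩
    linarith
  · have : H ≤ 2 ^ (1 - p) * H := le_mul_of_one_le_left hH hone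
    linarith

/-- The characteristic of an interval that contains a solution is bounded below by a multiple of
its length in the Hölder metric. -/
theorem le_charac (hN : 1 ≤ N) (hH : 0 ≤ H) (hξ : 0 < ξ) (hr : 1 < r) {xs : ℝ}
    (hz : ∀ x ∈ T, zAt g T x ≤ H * |x - xs| ^ (1 / (N : ℝ)))
    {j : ℕ} (hj : 1 ≤ j) (hj' : j < T.card) (hxs : xs ∈ Set.Icc (point T (j - 1)) (point T j))
    (hlt : 2 * (2 ^ (1 - 1 / (N : ℝ)) * H) < r * ξ) :
    (1 - 2 * (2 ^ (1 - 1 / (N : ℝ)) * H) / (r * ξ)) * hlen N T j ≤ charac N g ξ r T j := by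
  have zl := zval_le_left hz hj' hxs
  have zr := zval_le_right hz hj' hxs
  have z1 := zval_nonneg (g := g) hj'
  have z0 := zval_nonneg (g := g) (T := T) (i := j - 1) (by omega)
  have d0 := sub_nonneg.2 hxs.1
  have d1 := sub_nonneg.2 hxs.2
  have hsum := rpow_add_rpow_le hN d0 d1
  have hlen_eq : (xs - point T (j - 1) + (point T j - xs)) ^ (1 / (N : ℝ)) = hlen N T j := by
    rw [hlen]
    congr 1
    ring
  rw [hlen_eq] at hsum
  have hp : (0 : ℝ) < 1 / N := by positivity
  have hone : (1 : ℝ) ≤ 2 ^ (1 - 1 / (N : ℝ)) := one_le_two_rpow hN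
  have hΔ := hlen_pos (N := N) hj hj'
  have l1 : (xs - point T (j - 1)) ^ (1 / (N : ℝ)) ≤ hlen N T j :=
    Real.rpow_le_rpow d0 (by linarith [hxs.2]) hp.le
  have l2 : (point T j - xs) ^ (1 / (N : ℝ)) ≤ hlen N T j :=
    Real.rpow_le_rpow d1 (by linarith [hxs.1]) hp.le
  have hrξ : 0 < r * ξ := by positivity
  have hrM : r * ξ ≤ r * mEst N g ξ T j :=
    mul_le_mul_of_nonneg_left (xi_le_mEst j) (by linarith)
  set u := r * mEst N g ξ T j
  set q := (2 : ℝ) ^ (1 - 1 / (N : ℝ))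
  set Δ := hlen N T j
  have hu : 0 < u := hrξ.trans_le hrM
  have hqH : H ≤ q * H := le_mul_of_one_le_left hH hone
  have hbd : ∀ w, 0 ≤ w → w ≤ 2 * (q * H) * Δ → w / u ≤ 2 * (q * H) / (r * ξ) * Δ := by
    intro w hw hw'
    rw [div_mul_eq_mul_div]
    exact div_le_div₀ (hw.trans hw') hw' hrξ hrM
  have hε : 0 ≤ 1 - 2 * (q * H) / (r * ξ) := by
    rw [sub_nonneg]
    exact (div_le_one hrξ).2 hlt.le
  unfold charac
  split_ifs with h h'
  -- Concavity bounds the sum of the two values by qHΔ; the quadratic term is nonnegative and is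
  -- dropped.
  · have h1 : 2 * (zval g T j + zval g T (j - 1)) / u ≤ 2 * (q * H) / (r * ξ) * Δ := by
      refine hbd _ (by positivity) ?_
      have := mul_le_mul_of_nonneg_left hsum hH
      nlinarith
    have h2 : 0 ≤ (zval g T j - zval g T (j - 1)) ^ 2 / (u ^ 2 * Δ) := by positivity
    linarith
  -- With different indices a single value enters, at most HΔ ≤ qHΔ; this even gives twice the
  -- claimed lower bound.
  · have h1 : 2 * zval g T j / u ≤ 2 * (q * H) / (r * ξ) * Δ := by
      refine hbd _ (by positivity) ?_
      have := mul_le_mul hqH l2 (by positivity) (by positivity)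
      have := mul_le_mul_of_nonneg_left l2 hH
      linarith
    have h3 : 4 * zval g T j / u = 2 * (2 * zval g T j / u) := by ring
    nlinarith
  · have h1 : 2 * zval g T (j - 1) / u ≤ 2 * (q * H) / (r * ξ) * Δ := by
      refine hbd _ (by positivity) ?_
      have := mul_le_mul hqH l1 (by positivity) (by positivity)
      have := mul_le_mul_of_nonneg_left l1 hH
      linarith
    have h3 : 4 * zval g T (j - 1) / u = 2 * (2 * zval g T (j - 1) / u) := by ring
    nlinarith

/-! ### Convergence -/

/-- A sequence in `[0, 1]` has terms arbitrarily close to each other. -/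
theorem exists_abs_sub_lt {u : ℕ → ℝ} (hu : ∀ n, u n ∈ Set.Icc (0 : ℝ) 1) {δ : ℝ} (hδ : 0 < δ)
    (K : ℕ) : ∃ n k, K ≤ n ∧ n < k ∧ |u k - u n| < δ := by
  obtain ⟨a, -, φ, hφ, hlim⟩ := isCompact_Icc.tendsto_subseq hu
  obtain ⟨n, hn⟩ := Metric.cauchySeq_iff.1 hlim.cauchySeq δ hδ
  refine ⟨φ (max n K), φ (max n K + 1), (le_max_right n K).trans (hφ.id_le _),
    hφ (Nat.lt_succ_self _), ?_⟩
  exact hn (max n K + 1) (by simp only [ge_iff_le]; omega) (max n K) (le_max_left _ _)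

theorem trial_mem_Icc (hN : 1 ≤ N) (hξ : 0 < ξ) (hr : 1 < r) (n : ℕ) :
    trial N g ξ r n ∈ Set.Icc (0 : ℝ) 1 :=
  (trialSet_spec hN hξ hr n).2.2.2 _ (mem_trialSet_iff.2 ⟨n, by omega, rfl⟩)

/-- If `xs` is not a limit point, then the trial points different from `xs` stay away from it. -/
theorem exists_le_dist_trial {xs : ℝ}
    (h : ¬ MapClusterPt xs Filter.atTop (trial N g ξ r)) :
    ∃ ρ > 0, ∀ n, trial N g ξ r n ≠ xs → ρ ≤ |trial N g ξ r n - xs| := by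
  rw [mapClusterPt_iff_frequently] at h
  push Not at h
  obtain ⟨s, hs, hev⟩ := h
  obtain ⟨ρ, hρ, hball⟩ := Metric.mem_nhds_iff.1 hs
  obtain ⟨K, hK⟩ := Filter.eventually_atTop.1 hev
  -- The finitely many early trial points may come close to xs or hit it; a minimum over those that
  -- miss it is positive.
  obtain ⟨ρ', hρ', hfin⟩ : ∃ ρ' > 0, ∀ n < K, trial N g ξ r n ≠ xs →
      ρ' ≤ |trial N g ξ r n - xs| := by
    clear hK
    induction K with
    | zero => exact ⟨1, one_pos, by simp⟩
    | succ K ih =>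
      obtain ⟨ρ', hρ', hfin⟩ := ih
      by_cases he : trial N g ξ r K = xs
      · refine ⟨ρ', hρ', fun n hn hne => ?_⟩
        rcases Nat.lt_succ_iff_lt_or_eq.1 hn with h | rfl
        · exact hfin n h hne
        · exact absurd he hne
      · refine ⟨min ρ' |trial N g ξ r K - xs|, lt_min hρ' (abs_pos.2 (sub_ne_zero.2 he)),
          fun n hn hne => ?_⟩
        rcases Nat.lt_succ_iff_lt_or_eq.1 hn with h | rfl
        · exact (min_le_left _ _).trans (hfin n h hne)
        · exact min_le_right _ _
  refine ⟨min ρ ρ', lt_min hρ hρ', fun n hne => ?_⟩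
  rcases Nat.lt_or_ge n K with hn | hn
  · exact (min_le_right _ _).trans (hfin n hn hne)
  · refine (min_le_left _ _).trans ?_
    by_contra! hlt
    exact hK n hn (hball hlt)

theorem mapClusterPt_trial (hN : 1 ≤ N) (hH : 0 ≤ H) (hξ : 0 < ξ) (hr : 1 < r) {xs : ℝ}
    (hxs : xs ∈ Set.Icc (0 : ℝ) 1)
    (hz : ∀ k, ∀ x ∈ trialSet N g ξ r (k + 1),
      zAt g (trialSet N g ξ r (k + 1)) x ≤ H * |x - xs| ^ (1 / (N : ℝ)))
    (hlt : 2 * (2 ^ (1 - 1 / (N : ℝ)) * H) < r * ξ) :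
    MapClusterPt xs Filter.atTop (trial N g ξ r) := by
  by_contra hcl
  obtain ⟨ρ, hρ, hfar⟩ := exists_le_dist_trial hcl
  have hrξ : 0 < r * ξ := by positivity
  set ε := 1 - 2 * (2 ^ (1 - 1 / (N : ℝ)) * H) / (r * ξ) with hεdef
  have hε : 0 < ε := sub_pos.2 ((div_lt_one hrξ).2 hlt)
  -- From ερ^(1/N) ≤ R_j ≤ R_t ≤ 2Δ_t one gets Δ_t ≥ η, and the new point is then at least (1 -
  -- 1/r)/2·η^N away from all earlier ones.
  set η := ε * ρ ^ (1 / (N : ℝ)) / 2 with hη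
  have hη0 : 0 < η := by positivity
  have hr' : 0 < (1 - 1 / r) / 2 := by
    have : 1 / r < 1 := (div_lt_one (by linarith)).2 hr
    linarith
  -- Starting from index 1 makes k ≥ 2, so the later term is a point generated by the algorithm.
  obtain ⟨n, k, hn, hnk, hclose⟩ := exists_abs_sub_lt (trial_mem_Icc (g := g) hN hξ hr)
    (δ := (1 - 1 / r) / 2 * η ^ N) (by positivity) 1
  obtain ⟨k, rfl⟩ : ∃ k', k = k' + 2 := ⟨k - 2, by omega⟩
  obtain ⟨hcard, h0, h1, hI⟩ := trialSet_spec (g := g) hN hξ hr k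
  have hzk := hz k
  have hmem : trial N g ξ r n ∈ trialSet N g ξ r (k + 1) :=
    mem_trialSet_iff.2 ⟨n, by omega, rfl⟩
  have hfar' : ∀ x ∈ trialSet N g ξ r (k + 1), x ≠ xs → ρ ≤ |x - xs| := by
    intro x hx hne
    obtain ⟨n', -, rfl⟩ := mem_trialSet_iff.1 hx
    exact hfar n' hne
  rw [trial] at hclose
  set T := trialSet N g ξ r (k + 1)
  obtain ⟨b1, b2, b3⟩ := bestInterval_spec (N := N) (g := g) (ξ := ξ) (r := r) (T := T) (by omega)
  obtain ⟨j, j1, j2, hxj⟩ := exists_mem_interval T h0 h1 hxs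
  -- Even if xs is a trial point, at least one end of the interval differs from it and is at
  -- distance at least ρ.
  have hlen_j : ρ ≤ point T j - point T (j - 1) := by
    by_cases he : point T j = xs
    · have hlt := point_lt T (show j - 1 < j by omega) (by omega)
      have := hfar' _ (point_mem T (i := j - 1) (by omega)) (by rw [← he]; exact hlt.ne)
      rw [abs_sub_comm, abs_of_nonneg (sub_nonneg.2 hxj.1)] at this
      linarith
    · have := hfar' _ (point_mem T (i := j) (by omega)) he
      rw [abs_of_nonneg (sub_nonneg.2 hxj.2)] at this
      linarith [hxj.1]
  have hΔj : ρ ^ (1 / (N : ℝ)) ≤ hlen N T j := Real.rpow_le_rpow hρ.le hlen_j (by positivity)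
  have hR := le_charac hN hH hξ hr hzk j1 (by omega) hxj hlt
  have hRt := (hR.trans (b3 j j1 j2)).trans (charac_le hξ hr b1 b2)
  have hηt : η ≤ hlen N T (bestInterval N g ξ r T) := by
    have := mul_le_mul_of_nonneg_left hΔj hε.le
    rw [hη]
    linarith
  have hηN := pow_le_pow_left₀ hη0.le hηt N
  rw [hlen_pow hN b1 b2] at hηN
  have := le_dist_newPoint (N := N) (g := g) hN hξ hr b1 b2 hmem
  have := mul_le_mul_of_nonneg_left hηN hr'.le
  linarith

end Algorithm

/-! ### From Lipschitz data on the cube to the reduced problem -/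

theorem holderOn_reduced {N m : ℕ} (hN : 1 ≤ N)
    {G : Fin (m + 1) → EuclideanSpace ℝ (Fin N) → ℝ} {L : Fin (m + 1) → ℝ}
    (hL : ∀ i, ∀ y' ∈ region G i, ∀ y'' ∈ region G i, |G i y' - G i y''| ≤ L i * ‖y' - y''‖)
    {Lmax : ℝ} (hmax : ∀ i, L i ≤ Lmax) (h0 : 0 ≤ Lmax) (S : PeanoOrder N)
    {γ : ℝ → EuclideanSpace ℝ (Fin N)} (hγ : γ = S.curve ∨ ∃ d, γ = S.polygon d) :
    HolderOn (reduced G γ) N (2 * √((N : ℝ) + 3) * Lmax) := by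
  have hcube : ∀ x ∈ Set.Icc (0 : ℝ) 1, γ x ∈ searchCube N := by
    intro x hx
    rcases hγ with rfl | ⟨d, rfl⟩
    · exact S.curve_mem_searchCube x
    · exact S.polygon_mem_searchCube d hx
  intro i x hx x' hx'
  calc |G i (γ x) - G i (γ x')| ≤ L i * ‖γ x - γ x'‖ :=
        hL i _ ⟨hcube x hx.1, hx.2⟩ _ ⟨hcube x' hx'.1, hx'.2⟩
    _ ≤ Lmax * (2 * √((N : ℝ) + 3) * |x - x'| ^ (1 / (N : ℝ))) :=
        mul_le_mul (hmax i) (S.holder hN hγ hx.1 hx'.1) (norm_nonneg _) h0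
    _ = _ := by ring

/-- The first domain is the whole cube, which contains two distinct points. A later domain may have
at most one point and allow a negative constant, so the sign of the maximum rests on this one. -/
theorem lipschitz_const_nonneg {N m : ℕ} (hN : 1 ≤ N)
    {G : Fin (m + 1) → EuclideanSpace ℝ (Fin N) → ℝ} {L : Fin (m + 1) → ℝ}
    (hL : ∀ i, ∀ y' ∈ region G i, ∀ y'' ∈ region G i, |G i y' - G i y''| ≤ L i * ‖y' - y''‖) :
    0 ≤ L 0 := by
  have hmem : ∀ t : ℝ, -1 / 2 ≤ t → t ≤ 1 / 2 →
      (WithLp.toLp 2 fun _ => t : EuclideanSpace ℝ (Fin N)) ∈ region G 0 :=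
    fun t h1 h2 => ⟨fun _ => ⟨h1, h2⟩, fun j hj => absurd hj (Fin.not_lt_zero j)⟩
  have h := (abs_nonneg _).trans
    (hL 0 _ (hmem 0 (by norm_num) (by norm_num)) _ (hmem (1 / 2) (by norm_num) le_rfl))
  refine nonneg_of_mul_nonneg_left h (norm_pos_iff.2 (sub_ne_zero.2 fun he => ?_))
  have := congrArg (fun y : EuclideanSpace ℝ (Fin N) => y ⟨0, hN⟩) he
  norm_num at this

theorem theorem3 (N m : ℕ) (hN : 1 ≤ N)
    (G : Fin (m + 1) → EuclideanSpace ℝ (Fin N) → ℝ) (L : Fin (m + 1) → ℝ)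
    (hL : ∀ i, ∀ y' ∈ region G i, ∀ y'' ∈ region G i, |G i y' - G i y''| ≤ L i * ‖y' - y''‖)
    (ξ : ℝ) (hξ : 0 < ξ) :
    ∃ rs : ℝ,
      rs = (2 : ℝ) ^ (3 - 1 / (N : ℝ)) * ξ⁻¹ * √((N : ℝ) + 3)
          * Finset.univ.sup' Finset.univ_nonempty L ∧
      ∀ (S : PeanoOrder N) (γ : ℝ → EuclideanSpace ℝ (Fin N)),
        (γ = S.curve ∨ ∃ d, γ = S.polygon d) →
        (reducedRegion (reduced G γ) (Fin.last m)).Nonempty →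
        ∀ r : ℝ, 1 < r → rs < r →
        ∀ xs : ℝ, IsSolution (reduced G γ) xs →
          (∀ k, 1 ≤ k → ∀ j, 1 ≤ j → j ≤ k →
            xs ∈ Set.Icc (point (trialSet N (reduced G γ) ξ r k) (j - 1))
              (point (trialSet N (reduced G γ) ξ r k) j) →
            ConvCondition N (reduced G γ) ξ r (trialSet N (reduced G γ) ξ r k) xs j) ∧
          MapClusterPt xs Filter.atTop (trial N (reduced G γ) ξ r) := by
  refine ⟨_, rfl, fun S γ hγ hne r hr hrs xs hxs => ?_⟩
  set Lmax := Finset.univ.sup' Finset.univ_nonempty L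
  have hmax : ∀ i, L i ≤ Lmax := fun i => Finset.le_sup' L (Finset.mem_univ i)
  have hL0 : 0 ≤ Lmax := (lipschitz_const_nonneg hN hL).trans (hmax 0)
  have hg := holderOn_reduced hN hL hmax hL0 S hγ
  have hH : 0 ≤ 2 * √((N : ℝ) + 3) * Lmax := by positivity
  obtain ⟨hreg, hmin⟩ := hxs.spec hne
  have hz : ∀ k, ∀ x ∈ trialSet N (reduced G γ) ξ r (k + 1),
      zAt (reduced G γ) (trialSet N (reduced G γ) ξ r (k + 1)) x ≤
        2 * √((N : ℝ) + 3) * Lmax * |x - xs| ^ (1 / (N : ℝ)) :=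
    fun k x hx => zAt_le hg (trialSet_spec hN hξ hr k).2.2.2 hreg hmin hx
  -- This is r*ξ < rξ, since 2^(3-1/N) = 2·2^(1-1/N)·2, the last factor 2 belonging to the Hölder
  -- constant.
  have hlt : 2 * ((2 : ℝ) ^ (1 - 1 / (N : ℝ)) * (2 * √((N : ℝ) + 3) * Lmax)) < r * ξ := by
    have e : (2 : ℝ) ^ (3 - 1 / (N : ℝ)) = 4 * 2 ^ (1 - 1 / (N : ℝ)) := by
      rw [show (3 : ℝ) - 1 / N = 2 + (1 - 1 / N) by ring, Real.rpow_add (by norm_num)]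
      norm_num
    have h1 := mul_lt_mul_of_pos_right hrs hξ
    rw [e] at h1
    refine lt_of_eq_of_lt ?_ h1
    field_simp
    ring
  refine ⟨fun k hk j hj hjk hmem => ?_, mapClusterPt_trial hN hH hξ hr hxs.1 hz hlt⟩
  obtain ⟨k, rfl⟩ := Nat.exists_eq_succ_of_ne_zero (show k ≠ 0 by omega)
  have hcard := (trialSet_spec (g := reduced G γ) hN hξ hr k).1
  exact convCondition_of_lt hN hH (hz k) hj (by omega) hmem
    (hlt.trans_le (mul_le_mul_of_nonneg_left (xi_le_mEst j) (by linarith)))
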